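/- **Definitions.** An applicative structure is a set $A$ with a binary operation $(a,b)\mapsto a\,b$ (associating to the left). Given elements $B,C^{+},C^{-},I\in A$, write $a\circ b=B\,a\,b$, $a^{0}=I$, $a^{n+1}=a\circ a^{n}$ and $a^{\bullet}=C^{+}\,I\,a$. A *ribbon combinatory algebra* is an applicative structure $A$ with elements $B,C^{+},C^{-},I,\theta^{+},\theta^{-},Tr$ such that for all $a,b,c\in A$ (signs $\pm,\mp$ linked within an equation) * (extensional $\mathbf{BC^{\pm}I}$-algebra) $B\,a\,b\,c=a\,(b\,c)$; $C^{+}a\,b\,c=a\,c\,b$; $I\,a=a$; $C^{+}a\,b=C^{-}a\,b$; $B\,I=I$; $C^{+}B\,I=B\,I$; $(C^{+}B\,B)\circ(B\circ B)=(B\,B)\circ B$; $C^{\pm}\circ C^{\mp}=B\,(B\,I)$; $(C^{+}B\,C^{\pm})\circ(B\circ B)=(B\,C^{\pm})\circ(B\circ B)$; $(B\,C^{\pm})\circ(C^{\pm}\circ(B\,C^{\pm}))=C^{\pm}\circ((B\,C^{\pm})\circ C^{\pm})$; $(B\,B)\circ C^{\pm}=C^{\pm}\circ((B\,C^{\pm})\circ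 B)$; * (balanced) $(B\,\theta^{\pm})\circ B=(C^{+}B\,\theta^{\pm})\circ B$; $\theta^{\pm}\circ\theta^{\mp}=B\,I$; $C^{+}\theta^{\pm}a=C^{+}I\,a$; $B\circ\theta^{\pm}=\theta^{\pm}\circ C^{\pm}\circ\theta^{\pm}\circ C^{\pm}\circ B$; * (traced) $(C^{+}B\,Tr)\circ B=(B\,Tr)\circ B^{2}$; $(B\,Tr)\circ(C^{+}B\,B)\circ B=B\circ Tr$; $Tr\,C^{\pm}=\theta^{\pm}$; $Tr^{2}\circ(C^{+}B\,C^{-})\circ(B\,C^{+})=Tr^{2}$. An element $a$ has arity $m\to n$ if $a^{\bullet}\circ B^{m+1}=(B\,a)\circ B^{n}$. The *internal PROB* $\mathcal I_A$ is the strict monoidal category whose objects are the natural numbers, with tensor product $m+n$ and unit $0$, whose morphisms $m\to n$ are the elements of arity $m\to n$, with composition $a;b=a\circ b$, identities $I$, $l+a=B^{l}\,a$ and $a+l=a$. Define elements $\sigma_{m,n}$ and $\theta_m$ by $\sigma_{0,1}=I$, $\sigma_{m+1,1}=(B\,\sigma_{m,1})\circ C^{+}$, $\sigma_{m,0}=I$,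 $\sigma_{m,n+1}=\sigma_{m,1}\circ(B\,\sigma_{m,n})$, $\theta_0=I$, $\theta_{m+1}=\theta^{+}\circ\sigma_{1,m}\circ\theta_m\circ\sigma_{m,1}$. A *ribbon category* is a braided monoidal category with braiding $\sigma$ and a natural isomorphism (twist) $\theta_X\colon X\to X$ satisfying $\theta_{X\otimes Y}=\sigma_{X,Y};(\theta_Y\otimes\theta_X);\sigma_{Y,X}$, in which every object $X$ has a chosen dual $X^{*}$ with unit $\eta_X\colon \mathbf 1\to X\otimes X^{*}$ and counit $\varepsilon_X\colon X^{*}\otimes X\to\mathbf 1$ ($\mathbf 1$ the tensor unit), and $(\theta_X)^{*}=\theta_{X^{*}}$. An object $X$ of a monoidal category is *reflexive* if it is equipped with bijections $\mathsf{cur}\colon\mathrm{Hom}(Y\otimes X,X)\to\mathrm{Hom}(Y,X)$ natural in $Y$; put $\mathsf{app}=\mathsf{cur}^{-1}(\mathrm{id}_X)\colon X\otimes X\to X$. A reflexive object $X$ of a ribbon category *induces* the following structure on $\mathrm{Hom}(\mathbf 1,X)$ (coherence isomorphisms suppressed): $a\cdot b=(a\otimes b);\mathsf{app}$, $I=\mathsf{cur}(\mathrm{id}_X)$,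 $B=\mathsf{cur}^{3}((X\otimes\mathsf{app});\mathsf{app})$, $C^{\pm}=\mathsf{cur}^{3}((X\otimes\sigma_{X,X}^{\pm1});(\mathsf{app}\otimes X);\mathsf{app})$, $\theta^{\pm}=\mathsf{cur}^{2}((X\otimes\theta_X^{\pm1});\mathsf{app})$, $Tr=\mathsf{cur}^{2}((X\otimes\mathsf{lam});(\mathsf{app}\otimes X);\mathsf{app})$, where $\varphi=\mathsf{cur}(X\otimes\varepsilon_X)\colon X\otimes X^{*}\to X$ and $\mathsf{lam}=(X\otimes\eta_X);(X\otimes X\otimes\theta_{X^{*}});(X\otimes\sigma_{X,X^{*}});(\varphi\otimes X)\colon X\to X\otimes X$. **Theorem.** Let $A$ be a ribbon combinatory algebra. Then its internal PROB $\mathcal I_A$ is a ribbon category, with braiding $\sigma_{m,n}\colon m+n\to n+m$ and twist $\theta_m\colon m\to m$, and $1$ is a reflexive object of it, with $\mathsf{app}=B\colon 2\to1$. The algebra $\mathcal I_A(0,1)$ induced by this reflexive object is isomorphic to $A$: the map $a\mapsto a^{\bullet}$ is a bijection $A\to\mathcal I_A(0,1)$ that preserves application and the elements $B,C^{+},C^{-},I,\theta^{+},\theta^{-},Tr$.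 -/

import Mathlib

open CategoryTheory MonoidalCategory

universe u v w

/-! ### Ribbon combinatory algebras -/

/-- An applicative structure with distinguished elements `B`, `C⁺`, `C⁻`, `I`, `θ⁺`, `θ⁻`, `Tr`
(no axioms). -/
class RibbonSignature (A : Type u) where
  app : A → A → A
  B : A
  Cp : A
  Cm : A
  I : A
  θp : A
  θm : A
  Tr : A

namespace RibbonSignature

infixl:100 " ⬝ " => RibbonSignature.app

/-- `a ⊚ b = B a b` (run `a` first, then `b`). -/
def comp {A : Type u} [RibbonSignature A] (a b : A) : A := B ⬝ a ⬝ b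

infixr:90 " ⊚ " => RibbonSignature.comp

/-- `a ^ n` with respect to `⊚`: `a ^ 0 = I`, `a ^ (n + 1) = a ⊚ a ^ n`. -/
def npow {A : Type u} [RibbonSignature A] (a : A) : ℕ → A
  | 0 => I
  | n + 1 => a ⊚ npow a n

/-- The element `a•`, i.e. `C⁺ I a`. -/
def dot {A : Type u} [RibbonSignature A] (a : A) : A := Cp ⬝ I ⬝ a

/-- `a : m → n`, i.e. `a• ∘ B ^ (m + 1) = (B a) ∘ B ^ n`. -/
def HasArity {A : Type u} [RibbonSignature A] (m n : ℕ) (a : A) : Prop :=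
  dot a ⊚ npow B (m + 1) = (B ⬝ a) ⊚ npow B n

/-- The elements `σ_{m,1}`. -/
def sigmaOne {A : Type u} [RibbonSignature A] : ℕ → A
  | 0 => I
  | m + 1 => (B ⬝ sigmaOne m) ⊚ Cp

/-- The elements `σ_{m,n} : m + n → n + m`. -/
def sigma {A : Type u} [RibbonSignature A] (m : ℕ) : ℕ → A
  | 0 => I
  | n + 1 => sigmaOne m ⊚ (B ⬝ sigma m n)

/-- The elements `θ_m : m → m`. -/
def theta {A : Type u} [RibbonSignature A] : ℕ → A
  | 0 => I
  | m + 1 => θp ⊚ sigma 1 m ⊚ theta m ⊚ sigma m 1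

/-- Isomorphisms: bijections preserving the application and all distinguished elements. -/
structure Iso {A : Type u} {A' : Type v} (S : RibbonSignature A) (S' : RibbonSignature A')
    extends A ≃ A' where
  map_app : ∀ a b : A, toFun (S.app a b) = S'.app (toFun a) (toFun b)
  map_B : toFun S.B = S'.B
  map_Cp : toFun S.Cp = S'.Cp
  map_Cm : toFun S.Cm = S'.Cm
  map_I : toFun S.I = S'.I
  map_θp : toFun S.θp = S'.θp
  map_θm : toFun S.θm = S'.θm
  map_Tr : toFun S.Tr = S'.Tr

end RibbonSignature

open RibbonSignature in
/-- Ribbon combinatory algebras: traced balanced extensional `BC±I`-algebras. -/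
class RibbonCombinatoryAlgebra (A : Type u) extends RibbonSignature A where
  -- extensional `BC±I`-algebra
  B_app : ∀ a b c : A, B ⬝ a ⬝ b ⬝ c = a ⬝ (b ⬝ c)
  C_app : ∀ a b c : A, Cp ⬝ a ⬝ b ⬝ c = a ⬝ c ⬝ b
  I_app : ∀ a : A, I ⬝ a = a
  C_two : ∀ a b : A, Cp ⬝ a ⬝ b = Cm ⬝ a ⬝ b
  lam : B ⬝ I = (I : A)
  rho : Cp ⬝ B ⬝ I = B ⬝ (I : A)
  alpha : (Cp ⬝ B ⬝ B) ⊚ (B ⊚ B) = (B ⬝ B) ⊚ (B : A)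
  cox₁_pos : Cp ⊚ Cm = B ⬝ (B ⬝ (I : A))
  cox₁_neg : Cm ⊚ Cp = B ⬝ (B ⬝ (I : A))
  cox₂_pos : (Cp ⬝ B ⬝ Cp) ⊚ (B ⊚ B) = (B ⬝ Cp) ⊚ (B ⊚ (B : A))
  cox₂_neg : (Cp ⬝ B ⬝ Cm) ⊚ (B ⊚ B) = (B ⬝ Cm) ⊚ (B ⊚ (B : A))
  cox₃_pos : (B ⬝ Cp) ⊚ (Cp ⊚ (B ⬝ Cp)) = Cp ⊚ ((B ⬝ Cp) ⊚ (Cp : A))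
  cox₃_neg : (B ⬝ Cm) ⊚ (Cm ⊚ (B ⬝ Cm)) = Cm ⊚ ((B ⬝ Cm) ⊚ (Cm : A))
  bc_pos : (B ⬝ B) ⊚ Cp = Cp ⊚ ((B ⬝ Cp) ⊚ (B : A))
  bc_neg : (B ⬝ B) ⊚ Cm = Cm ⊚ ((B ⬝ Cm) ⊚ (B : A))
  -- balanced
  theta₁_pos : (B ⬝ θp) ⊚ B = (Cp ⬝ B ⬝ θp) ⊚ (B : A)
  theta₁_neg : (B ⬝ θm) ⊚ B = (Cp ⬝ B ⬝ θm) ⊚ (B : A)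
  theta₂_pos : θp ⊚ θm = B ⬝ (I : A)
  theta₂_neg : θm ⊚ θp = B ⬝ (I : A)
  theta₃_pos : ∀ a : A, Cp ⬝ θp ⬝ a = Cp ⬝ I ⬝ a
  theta₃_neg : ∀ a : A, Cp ⬝ θm ⬝ a = Cp ⬝ I ⬝ a
  theta₄_pos : B ⊚ θp = θp ⊚ Cp ⊚ θp ⊚ Cp ⊚ (B : A)
  theta₄_neg : B ⊚ θm = θm ⊚ Cm ⊚ θm ⊚ Cm ⊚ (B : A)
  -- traced
  left_tightening : (Cp ⬝ B ⬝ Tr) ⊚ B = (B ⬝ Tr) ⊚ npow (B : A) 2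
  right_tightening : (B ⬝ Tr) ⊚ (Cp ⬝ B ⬝ B) ⊚ B = B ⊚ (Tr : A)
  yanking_pos : Tr ⬝ Cp = (θp : A)
  yanking_neg : Tr ⬝ Cm = (θm : A)
  exchange : npow Tr 2 ⊚ (Cp ⬝ B ⬝ Cm) ⊚ (B ⬝ Cp) = npow (Tr : A) 2

/-! ### Basic facts needed to build the internal PROB -/

namespace RibbonCombinatoryAlgebra

open RibbonSignature

variable {A : Type u} [RibbonCombinatoryAlgebra A]

theorem comp_app (a b c : A) : (a ⊚ b) ⬝ c = a ⬝ (b ⬝ c) := B_app a b c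

theorem I_comp (a : A) : I ⊚ a = a := by
  unfold comp; rw [lam, I_app]

theorem comp_I (a : A) : a ⊚ I = a := by
  have := C_app (B : A) I a
  rw [rho, lam, I_app] at this
  exact this.symm

theorem B_comp (a b : A) : B ⬝ (a ⊚ b) = (B ⬝ a) ⊚ (B ⬝ b) := by
  have h := congrArg (fun z : A => z ⬝ a ⬝ b) (alpha (A := A))
  simp only [comp_app, C_app, B_app] at h
  exact h.symm

theorem comp_assoc (a b c : A) : (a ⊚ b) ⊚ c = a ⊚ (b ⊚ c) := by
  change B ⬝ (a ⊚ b) ⬝ c = _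
  rw [B_comp, comp_app]; rfl

theorem C_eq (x y : A) : Cp ⬝ x ⬝ y = dot y ⊚ x := by
  have h := congrArg (fun z : A => z ⬝ I ⬝ y ⬝ x) (bc_pos (A := A))
  simp only [comp_app, lam, B_app] at h
  change dot y ⊚ x = Cp ⬝ (Cp ⊚ I) ⬝ y ⬝ x at h
  rw [h, comp_I, C_app]

theorem dot_app' (a b : A) : dot a ⬝ b = b ⬝ a := by
  unfold dot; rw [C_app, I_app]

/-- `B a` slides past an element of the form `C x`. -/
theorem slide_C (a x : A) : (B ⬝ a) ⊚ (Cp ⬝ x) = Cp ⬝ ((B ⬝ a) ⊚ x) := by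
  have h := congrArg (fun z : A => z ⬝ a ⬝ x) (cox₂_pos (A := A))
  simp only [comp_app, C_app, B_app] at h
  exact h

theorem comp_dot (y b : A) : y ⊚ dot b = dot b ⊚ (B ⬝ y) := by
  have h := congrArg (fun z : A => z ⬝ b) (slide_C y I)
  simp only [comp_app, comp_I] at h
  rw [← C_eq]; exact h

theorem arity_B_slide (y : A) : (B ⬝ (B ⬝ y)) ⊚ B = B ⊚ (B ⬝ y) := by
  have h := congrArg (fun z : A => z ⬝ y) (alpha (A := A))
  simp only [comp_app, C_app] at h
  exact h

theorem Cm_C : (Cm : A) ⊚ Cp = I := by rw [cox₁_neg, lam, lam]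

theorem C_Cm : (Cp : A) ⊚ Cm = I := by rw [cox₁_pos, lam, lam]

theorem hexagon_B : (B : A) ⊚ Cp = (B ⬝ Cp) ⊚ Cp ⊚ (B ⬝ B) := by
  have h : (B ⬝ Cp) ⊚ Cp ⊚ ((B ⬝ B) ⊚ Cm) ⊚ (Cp : A) =
      (B ⬝ Cp) ⊚ Cp ⊚ (Cm ⊚ ((B ⬝ Cm) ⊚ B)) ⊚ Cp := by rw [bc_neg]
  have e1 : (B ⬝ Cp) ⊚ Cp ⊚ ((B ⬝ B) ⊚ Cm) ⊚ (Cp : A) = (B ⬝ Cp) ⊚ Cp ⊚ (B ⬝ B) := by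
    rw [comp_assoc (B ⬝ B), Cm_C, comp_I]
  have e2 : (B ⬝ Cp) ⊚ Cp ⊚ (Cm ⊚ ((B ⬝ Cm) ⊚ B)) ⊚ Cp = (B : A) ⊚ Cp := by
    rw [comp_assoc Cm, ← comp_assoc Cp Cm, C_Cm, I_comp, comp_assoc, ← comp_assoc (B ⬝ Cp),
      ← B_comp, C_Cm, lam, I_comp]
  rw [← e2, ← h, e1]

theorem dot_app (a b : A) : dot (a ⬝ b) = dot b ⊚ dot a ⊚ B := by
  have key : Cp ⊚ (Cp ⬝ (B : A)) = B ⬝ (Cp ⬝ I) := by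
    have h := congrArg (fun z : A => z ⬝ I) (hexagon_B (A := A))
    simp only [comp_app] at h
    rw [h]
    change _ = Cp ⊚ (Cp ⬝ (B ⊚ I))
    rw [comp_I]
  rw [← C_eq B a, ← C_eq]
  have h := congrArg (fun z : A => z ⬝ a ⬝ b) key
  simp only [comp_app, B_app] at h
  exact h.symm

theorem dot_comp (a b : A) : dot (a ⊚ b) = dot b ⊚ dot (B ⬝ a) ⊚ B := dot_app _ _

theorem dot_B_app (a : A) : dot (B ⬝ a) = dot a ⊚ dot B ⊚ B := dot_app _ _

theorem arity_B : dot (B : A) ⊚ B ⊚ B ⊚ B = (B ⬝ B) ⊚ B := by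
  rw [← alpha, C_eq, comp_assoc]

theorem npow_step (a : A) (n : ℕ) : npow a (n + 1) = a ⊚ npow a n := rfl

theorem npow_nil (a : A) : npow a 0 = I := rfl

theorem npow_sum (a : A) (m n : ℕ) : npow a (m + n) = npow a m ⊚ npow a n := by
  induction m with
  | zero => rw [Nat.zero_add, npow_nil, I_comp]
  | succ k ih => rw [Nat.succ_add, npow_step, npow_step, ih, comp_assoc]

theorem npow_step' (a : A) (n : ℕ) : npow a (n + 1) = npow a n ⊚ a := by
  rw [npow_sum]; congr 1; exact comp_I a

theorem npow_B_I (n : ℕ) : npow B n ⬝ I = (I : A) := by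
  induction n with
  | zero => exact I_app _
  | succ k ih => rw [npow_step, comp_app, ih, lam]

theorem npow_B_comp (n : ℕ) (a b : A) :
    npow B n ⬝ (a ⊚ b) = (npow B n ⬝ a) ⊚ (npow B n ⬝ b) := by
  induction n with
  | zero => simp only [npow_nil, I_app]
  | succ k ih => simp only [npow_step, comp_app, ih, B_comp]

theorem npow_B_add (m n : ℕ) (a : A) : npow B (m + n) ⬝ a = npow B m ⬝ (npow B n ⬝ a) := by
  rw [npow_sum, comp_app]

theorem npow_B_succ (n : ℕ) (a : A) : npow B (n + 1) ⬝ a = B ⬝ (npow B n ⬝ a) := by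
  rw [npow_step, comp_app]

theorem hasArity_I (n : ℕ) : HasArity n n (I : A) := by
  have h : dot (I : A) ⊚ B = I := by rw [← C_eq, rho, lam]
  unfold HasArity
  rw [npow_step, ← comp_assoc, h, lam]

theorem _root_.RibbonSignature.HasArity.succ {m n : ℕ} {a : A} (h : HasArity m n a) : HasArity (m + 1) (n + 1) a := by
  unfold HasArity at *
  rw [npow_step', ← comp_assoc, h, comp_assoc, ← npow_step']

theorem _root_.RibbonSignature.HasArity.add_right {m n : ℕ} {a : A} (h : HasArity m n a) (l : ℕ) :
    HasArity (m + l) (n + l) a := by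
  induction l with
  | zero => exact h
  | succ k ih => exact ih.succ

theorem _root_.RibbonSignature.HasArity.B_app {m n : ℕ} {a : A} (h : HasArity m n a) :
    HasArity (m + 1) (n + 1) (B ⬝ a) := by
  unfold HasArity at *
  calc dot (B ⬝ a) ⊚ npow B (m + 1 + 1)
      = dot a ⊚ (dot B ⊚ B ⊚ B ⊚ B) ⊚ npow B m := by
        rw [dot_B_app]; simp only [npow_step, comp_assoc]
    _ = (dot a ⊚ (B ⬝ B)) ⊚ npow B (m + 1) := by
        rw [arity_B]; simp only [npow_step, comp_assoc]
    _ = B ⊚ (B ⬝ a) ⊚ npow B n := by rw [← comp_dot, comp_assoc, h]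
    _ = (B ⬝ (B ⬝ a)) ⊚ npow B (n + 1) := by
        rw [← comp_assoc, ← arity_B_slide, comp_assoc, npow_step]

theorem _root_.RibbonSignature.HasArity.add_left {m n : ℕ} {a : A} (h : HasArity m n a) (l : ℕ) :
    HasArity (l + m) (l + n) (npow B l ⬝ a) := by
  induction l with
  | zero => rw [npow_nil, I_app, Nat.zero_add, Nat.zero_add]; exact h
  | succ k ih =>
    rw [npow_B_succ, Nat.succ_add, Nat.succ_add]; exact HasArity.B_app ih

theorem _root_.RibbonSignature.HasArity.comp {l m n : ℕ} {a b : A} (ha : HasArity l m a) (hb : HasArity m n b) :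
    HasArity l n (a ⊚ b) := by
  have hBa := HasArity.B_app ha
  unfold HasArity at *
  calc dot (a ⊚ b) ⊚ npow B (l + 1)
      = dot b ⊚ dot (B ⬝ a) ⊚ npow B (l + 1 + 1) := by
        rw [dot_comp]; simp only [npow_step, comp_assoc]
    _ = (dot b ⊚ (B ⬝ (B ⬝ a))) ⊚ npow B (m + 1) := by rw [hBa, comp_assoc]
    _ = (B ⬝ a) ⊚ (B ⬝ b) ⊚ npow B n := by rw [← comp_dot, comp_assoc, hb]
    _ = (B ⬝ (a ⊚ b)) ⊚ npow B n := by rw [B_comp, comp_assoc]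

/-- The interchange law. -/
theorem _root_.RibbonSignature.HasArity.interchange {m n : ℕ} {a : A} (h : HasArity m n a) (b : A) :
    (npow B m ⬝ b) ⊚ a = a ⊚ (npow B n ⬝ b) := by
  have h' := congrArg (fun z : A => z ⬝ b) h
  simp only [comp_app, dot_app', npow_B_succ] at h'
  exact h'

end RibbonCombinatoryAlgebra

/-! ### The internal PROB: the underlying strict monoidal category -/

/-- The objects of the internal PROB of `A` are the natural numbers. -/
structure InternalPROB (A : Type u) where
  deg : ℕ

namespace InternalPROB

open RibbonSignature RibbonCombinatoryAlgebra

variable {A : Type u} [RibbonCombinatoryAlgebra A]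

/-- Morphisms `m ⟶ n` are the elements of arity `m → n`. -/
@[ext]
structure Hom (X Y : InternalPROB A) where
  val : A
  arity : HasArity X.deg Y.deg val

instance category : Category (InternalPROB A) where
  Hom := Hom
  id X := ⟨I, hasArity_I X.deg⟩
  comp f g := ⟨f.val ⊚ g.val, f.arity.comp g.arity⟩
  id_comp f := Hom.ext (I_comp f.val)
  comp_id f := Hom.ext (comp_I f.val)
  assoc f g h := Hom.ext (comp_assoc f.val g.val h.val)

@[ext]
theorem hom_ext {X Y : InternalPROB A} {f g : X ⟶ Y} (h : f.val = g.val) : f = g := Hom.ext h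

@[simp] theorem id_val (X : InternalPROB A) : (𝟙 X : X ⟶ X).val = I := rfl

@[simp] theorem comp_val {X Y Z : InternalPROB A} (f : X ⟶ Y) (g : Y ⟶ Z) :
    (f ≫ g).val = f.val ⊚ g.val := rfl

/-- The identity between equal objects; its underlying element is `I`. -/
def isoOfEq {X Y : InternalPROB A} (h : X.deg = Y.deg) : X ≅ Y where
  hom := ⟨I, h ▸ hasArity_I X.deg⟩
  inv := ⟨I, h ▸ hasArity_I X.deg⟩
  hom_inv_id := hom_ext (I_comp I)
  inv_hom_id := hom_ext (I_comp I)

@[simp] theorem isoOfEq_hom_val {X Y : InternalPROB A} (h : X.deg = Y.deg) :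
    (isoOfEq h).hom.val = I := rfl

@[simp] theorem isoOfEq_inv_val {X Y : InternalPROB A} (h : X.deg = Y.deg) :
    (isoOfEq h).inv.val = I := rfl

/-- Tensor is addition on objects; `l + f = B ^ l f` and `f + l = f` on morphisms. All
structural isomorphisms are identities. -/
instance monoidalStruct : MonoidalCategoryStruct (InternalPROB A) where
  tensorObj X Y := ⟨X.deg + Y.deg⟩
  whiskerLeft X _ _ f := ⟨npow B X.deg ⬝ f.val, f.arity.add_left X.deg⟩
  whiskerRight f Y := ⟨f.val, f.arity.add_right Y.deg⟩
  tensorHom {_ Y₁ X₂ _} f g := ⟨f.val ⊚ (npow B Y₁.deg ⬝ g.val),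
    (f.arity.add_right X₂.deg).comp (g.arity.add_left Y₁.deg)⟩
  tensorUnit := ⟨0⟩
  associator X Y Z := isoOfEq (Nat.add_assoc X.deg Y.deg Z.deg)
  leftUnitor X := isoOfEq (Nat.zero_add X.deg)
  rightUnitor X := isoOfEq (Nat.add_zero X.deg)

@[simp] theorem tensorObj_deg (X Y : InternalPROB A) : (X ⊗ Y).deg = X.deg + Y.deg := rfl

@[simp] theorem tensorUnit_deg : (𝟙_ (InternalPROB A)).deg = 0 := rfl

@[simp] theorem whiskerLeft_val (X : InternalPROB A) {Y Z : InternalPROB A} (f : Y ⟶ Z) :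
    (X ◁ f).val = npow B X.deg ⬝ f.val := rfl

@[simp] theorem whiskerRight_val {Y Z : InternalPROB A} (f : Y ⟶ Z) (X : InternalPROB A) :
    (f ▷ X).val = f.val := rfl

@[simp] theorem tensorHom_val {X₁ Y₁ X₂ Y₂ : InternalPROB A} (f : X₁ ⟶ Y₁) (g : X₂ ⟶ Y₂) :
    (f ⊗ₘ g).val = f.val ⊚ (npow B Y₁.deg ⬝ g.val) := rfl

@[simp] theorem associator_hom_val (X Y Z : InternalPROB A) : (α_ X Y Z).hom.val = I := rfl

@[simp] theorem associator_inv_val (X Y Z : InternalPROB A) : (α_ X Y Z).inv.val = I := rfl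

@[simp] theorem leftUnitor_hom_val (X : InternalPROB A) : (λ_ X).hom.val = I := rfl

@[simp] theorem leftUnitor_inv_val (X : InternalPROB A) : (λ_ X).inv.val = I := rfl

@[simp] theorem rightUnitor_hom_val (X : InternalPROB A) : (ρ_ X).hom.val = I := rfl

@[simp] theorem rightUnitor_inv_val (X : InternalPROB A) : (ρ_ X).inv.val = I := rfl

instance monoidal : MonoidalCategory (InternalPROB A) where
  tensorHom_def f g := rfl
  id_tensorHom_id X Y := by ext; simp [npow_B_I, I_comp]
  tensorHom_comp_tensorHom {X₁ Y₁ Z₁ X₂ Y₂ Z₂} f₁ f₂ g₁ g₂ := by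
    ext
    simp only [comp_val, tensorHom_val, npow_B_comp, comp_assoc]
    rw [← comp_assoc (npow B Y₁.deg ⬝ f₂.val), g₁.arity.interchange, comp_assoc]
  whiskerLeft_id X Y := by ext; simp [npow_B_I]
  id_whiskerRight X Y := by ext; simp
  associator_naturality f₁ f₂ f₃ := by
    ext; simp [npow_B_comp, npow_B_add, comp_I, I_comp, comp_assoc]
  leftUnitor_naturality f := by ext; simp [npow_nil, I_app, I_comp, comp_I]
  rightUnitor_naturality f := by ext; simp [I_comp, comp_I]
  pentagon W X Y Z := by ext; simp [npow_B_I, I_comp]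
  triangle X Y := by ext; simp [npow_B_I, I_comp]

end InternalPROB

/-! ### Ribbon categories -/

/-- A balanced monoidal category: a braided monoidal category with a twist. -/
class BalancedCategory (C : Type u) [Category.{v} C] [MonoidalCategory C]
    extends BraidedCategory C where
  twist : ∀ X : C, X ≅ X
  twist_naturality : ∀ {X Y : C} (f : X ⟶ Y), f ≫ (twist Y).hom = (twist X).hom ≫ f
  twist_tensor : ∀ X Y : C,
    (twist (X ⊗ Y)).hom =
      (braiding X Y).hom ≫ ((twist Y).hom ⊗ₘ (twist X).hom) ≫ (braiding Y X).hom

/-- A ribbon category: a balanced monoidal category with chosen duals `Xᘁ` (with unit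
`𝟙_ C ⟶ X ⊗ Xᘁ` and counit `Xᘁ ⊗ X ⟶ 𝟙_ C`), such that `(θ_X)ᘁ = θ_{Xᘁ}`. -/
class RibbonCategory (C : Type u) [Category.{v} C] [MonoidalCategory C]
    extends BalancedCategory C, RightRigidCategory C where
  twist_dual : ∀ X : C, ((twist X).hom)ᘁ = (twist (Xᘁ)).hom

/-! ### Reflexive objects and the algebra they induce -/

/-- A (strictly) reflexive object: a representation of the functor `C(- ⊗ X, X)` by `X`. -/
abbrev ReflexiveStructure {C : Type u} [Category.{v} C] [MonoidalCategory C] (X : C) :=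
  ((tensorRight X).op ⋙ yoneda.obj X).RepresentableBy X

namespace ReflexiveStructure

section Monoidal

variable {C : Type u} [Category.{v} C] [MonoidalCategory C] {X : C}

/-- Currying `C(Y ⊗ X, X) → C(Y, X)`. -/
def cur (r : ReflexiveStructure X) {Y : C} (f : Y ⊗ X ⟶ X) : Y ⟶ X := r.homEquiv.symm f

/-- Application `X ⊗ X ⟶ X`. -/
def app (r : ReflexiveStructure X) : X ⊗ X ⟶ X := r.homEquiv (𝟙 X)

/-- The global element obtained by currying a map with one input. -/
def cur₁ (r : ReflexiveStructure X) (f : X ⟶ X) : 𝟙_ C ⟶ X := r.cur ((λ_ X).hom ≫ f)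

/-- The global element obtained by currying a map with two inputs. -/
def cur₂ (r : ReflexiveStructure X) (f : X ⊗ X ⟶ X) : 𝟙_ C ⟶ X :=
  r.cur (r.cur ((λ_ X).hom ▷ X ≫ f))

/-- The global element obtained by currying a map with three inputs. -/
def cur₃ (r : ReflexiveStructure X) (f : (X ⊗ X) ⊗ X ⟶ X) : 𝟙_ C ⟶ X :=
  r.cur (r.cur (r.cur ((λ_ X).hom ▷ X ▷ X ≫ f)))

end Monoidal

variable {C : Type u} [Category.{v} C] [MonoidalCategory C] [RibbonCategory C] {X : C}

/-- The map `φ : X ⊗ Xᘁ ⟶ X`, determined by `(φ ⊗ X) ≫ app = X ⊗ ε`. -/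
def phi (r : ReflexiveStructure X) : X ⊗ Xᘁ ⟶ X :=
  r.cur ((α_ X (Xᘁ) X).hom ≫ X ◁ ε_ X (Xᘁ) ≫ (ρ_ X).hom)

/-- The map `lam : X ⟶ X ⊗ X`, i.e. `(X ⊗ η) ≫ (X ⊗ X ⊗ θ) ≫ (X ⊗ σ) ≫ (φ ⊗ X)`. -/
def lam (r : ReflexiveStructure X) : X ⟶ X ⊗ X :=
  (ρ_ X).inv ≫ X ◁ η_ X (Xᘁ) ≫ X ◁ X ◁ (BalancedCategory.twist (Xᘁ)).hom ≫
    X ◁ (β_ X (Xᘁ)).hom ≫ (α_ X (Xᘁ) X).inv ≫ r.phi ▷ X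

/-- The application and the combinators on the global elements of a reflexive object in a
ribbon category. -/
abbrev signature (r : ReflexiveStructure X) : RibbonSignature (𝟙_ C ⟶ X) where
  app a b := (λ_ (𝟙_ C)).inv ≫ (a ⊗ₘ b) ≫ r.app
  B := r.cur₃ ((α_ X X X).hom ≫ X ◁ r.app ≫ r.app)
  Cp := r.cur₃ ((α_ X X X).hom ≫ X ◁ (β_ X X).hom ≫ (α_ X X X).inv ≫ r.app ▷ X ≫ r.app)
  Cm := r.cur₃ ((α_ X X X).hom ≫ X ◁ (β_ X X).inv ≫ (α_ X X X).inv ≫ r.app ▷ X ≫ r.app)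
  I := r.cur₁ (𝟙 X)
  θp := r.cur₂ (X ◁ (BalancedCategory.twist X).hom ≫ r.app)
  θm := r.cur₂ (X ◁ (BalancedCategory.twist X).inv ≫ r.app)
  Tr := r.cur₂ (X ◁ r.lam ≫ (α_ X X X).inv ≫ r.app ▷ X ≫ r.app)

end ReflexiveStructure

namespace RibbonCombinatoryAlgebra

open RibbonSignature

variable {A : Type u} [RibbonCombinatoryAlgebra A]

/-! ### Rewriting inside composites -/

/-! An element a of arity m → n is a map in continuation-passing style: its arity equation says a k
y₁ … yₘ = k z₁ … zₙ, where the zᵢ are the outputs on the inputs yᵢ. The points 0 → 1 are the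
elements `dot a`, and `B` : 2 → 1 is application. An f : m → 1 is recovered from the single element
`f ⬝ I` (`HasArity.eq_dot_comp`), so postcomposition with `B` is bijective onto the maps with one
more input. This is reflexivity of 1, and it lets maps into 1 be compared after application
(`eq_of_comp_B`).

Naturality of braiding and twist comes from the arity equation itself. Postcomposed with `Cp ⬝ I`,
`Cm ⬝ I` or `θp`, the powers of `B` in it turn these into σ_{1,n}, the inverse of σ_{n,1}, and
θ_{n+1}; cancelling what is invertible leaves the naturality squares (`sigma_one_naturality`,
`sigmaOneInv_naturality`, `theta_naturality`).

For duals, the object 1 is self-dual. Heuristically, elements are operators and `Tr` sends x to Σ_j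
|x⟩⟨j| ⊗ |j⟩. Up to braidings and twists, the counit `cap` is the trace form (b, c) ↦ tr(b ∘ c), and
the unit `cup` is its copairing Σ |i⟩⟨j| ⊗ |j⟩⟨i|. Applying either leg of `cup` to an argument gives
back `Tr` (`cup_comp_B_B`, `cup_comp_Cm_comp_B`), so both zigzags become trace computations using
tightening and yanking.

Reflexivity only separates maps with one output. For two outputs, `pair_ext` rebuilds the first
output from its values along the copairing `unitCup`. With it the twist slides from one leg of `cup`
to the other (`cup_comp_θp`), and for nested cups by induction (`cupPow_comp_theta`), which gives
the ribbon condition. `B_cup_comp_eq_Tr` identifies the categorical lam with `Tr`; the other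
combinators are matched after one, two or three applications. -/

theorem comp_eq_assoc {x y z : A} (h : x ⊚ y = z) (k : A) : x ⊚ y ⊚ k = z ⊚ k := by
  rw [← h, comp_assoc]

theorem comp_eq_assoc₃ {x y w z : A} (h : x ⊚ y ⊚ w = z) (k : A) : x ⊚ y ⊚ w ⊚ k = z ⊚ k := by
  rw [← h, comp_assoc, comp_assoc]

theorem B_congr {x y z : A} (h : x ⊚ y = z) : (B ⬝ x) ⊚ (B ⬝ y) = B ⬝ z := by rw [← B_comp, h]

theorem B_injective {x y : A} (h : B ⬝ x = B ⬝ y) : x = y := by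
  have h' := congrArg (fun z : A => z ⬝ I) h
  change x ⊚ I = y ⊚ I at h'
  rwa [comp_I, comp_I] at h'

/-! ### Global elements and currying -/

theorem dot_app_I (a : A) : dot a ⬝ I = a := by rw [dot_app', I_app]

theorem dot_injective {a b : A} (h : dot a = dot b) : a = b := by
  rw [← dot_app_I a, h, dot_app_I]

theorem dot_I_comp_B : dot (I : A) ⊚ B = I := by rw [← C_eq, rho, lam]

theorem hasArity_Cp : HasArity 2 2 (Cp : A) := by
  have h := cox₂_pos (A := A)
  rw [C_eq, comp_assoc] at h
  simpa only [HasArity, npow_step, npow_nil, comp_I] using h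

theorem hasArity_Cm : HasArity 2 2 (Cm : A) := by
  have h := cox₂_neg (A := A)
  rw [C_eq, comp_assoc] at h
  simpa only [HasArity, npow_step, npow_nil, comp_I] using h

theorem hasArity_B : HasArity 2 1 (B : A) := by
  simpa only [HasArity, npow_step, npow_nil, comp_I] using arity_B (A := A)

theorem hasArity_npow_B (n : ℕ) : HasArity (n + 1) 1 (npow (B : A) n) := by
  induction n with
  | zero => exact hasArity_I 1
  | succ n ih =>
    have h := hasArity_B (A := A).add_right n
    rw [show 2 + n = n + 1 + 1 by omega, Nat.add_comm 1 n] at h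
    exact h.comp ih

/-- Naturality of the crossing for points: the axiom `bc_pos` evaluated at `I` and then at a. -/
theorem dot_comp_Cp (a : A) : dot a ⊚ Cp = B ⬝ dot a := by
  have h := congrArg (fun z : A => z ⬝ I ⬝ a) (bc_pos (A := A))
  simp only [comp_app, lam] at h
  change (B ⊚ (Cp ⬝ I)) ⬝ a = Cp ⬝ (Cp ⊚ I) ⬝ a at h
  rw [comp_I, comp_app, C_eq Cp] at h
  exact h.symm

theorem dot_comp_Cm (a : A) : dot a ⊚ Cm = B ⬝ dot a := by
  have h := congrArg (fun z : A => z ⬝ I ⬝ a) (bc_neg (A := A))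
  simp only [comp_app, lam] at h
  change (B ⊚ (Cm ⬝ I)) ⬝ a = Cm ⬝ (Cm ⊚ I) ⬝ a at h
  rw [comp_I, comp_app, ← C_two, ← C_two, C_eq Cm] at h
  exact h.symm

theorem B_dot_comp_Cp (a : A) : (B ⬝ dot a) ⊚ Cp = dot a := by
  rw [← dot_comp_Cm, comp_assoc, Cm_C, comp_I]

theorem B_dot_comp_Cm (a : A) : (B ⬝ dot a) ⊚ Cm = dot a := by
  rw [← dot_comp_Cp, comp_assoc, C_Cm, comp_I]

/-- The contravariant rule `dot_app` expands `dot (C⁺ I a)`; the arity of `Cp` and `dot I ⊚ B = I`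
then leave a single crossing of `dot a`, which `dot_comp_Cp` resolves. -/
theorem hasArity_dot (a : A) : HasArity 0 1 (dot a) := by
  have h1 : dot (dot a) = dot a ⊚ dot (I : A) ⊚ dot Cp ⊚ B ⊚ B := by
    change dot (Cp ⬝ I ⬝ a) = _
    rw [dot_app, dot_app, comp_assoc, comp_assoc]
  have hC : dot (Cp : A) ⊚ B ⊚ B ⊚ B = (B ⬝ Cp) ⊚ B ⊚ B := by
    simpa only [HasArity, npow_step, npow_nil, comp_I] using hasArity_Cp (A := A)
  simp only [HasArity, npow_step, npow_nil, comp_I]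
  rw [h1]
  simp only [comp_assoc]
  rw [hC, ← comp_assoc (dot I), ← comp_dot, comp_assoc, ← comp_assoc (dot I), dot_I_comp_B, I_comp,
    ← comp_assoc, dot_comp_Cp]

/-- An element of arity `m → 1` is determined by its value at `I`. -/
theorem _root_.RibbonSignature.HasArity.eq_dot_comp {m : ℕ} {f : A} (h : HasArity m 1 f) :
    dot (f ⬝ I) ⊚ npow B m = f := by
  have h' : dot f ⊚ B ⊚ npow B m = (B ⬝ f) ⊚ B := by
    simpa only [HasArity, npow_step, npow_nil, comp_I] using h
  rw [dot_app, comp_assoc, comp_assoc, h', ← comp_assoc, ← comp_dot, comp_assoc, dot_I_comp_B,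
    comp_I]

/-- Currying for elements of arity `n + 1 → 1`. -/
def curry (n : ℕ) (f : A) : A := dot (f ⬝ I) ⊚ npow B n

theorem hasArity_curry (n : ℕ) (f : A) : HasArity n 1 (curry n f) := by
  have h := (hasArity_dot (f ⬝ I)).add_right n
  rw [Nat.zero_add, Nat.add_comm] at h
  exact h.comp (hasArity_npow_B n)

theorem curry_comp_B {n : ℕ} {f : A} (h : HasArity (n + 1) 1 f) : curry n f ⊚ B = f := by
  unfold curry
  rw [comp_assoc, ← npow_step', h.eq_dot_comp]

theorem eq_of_comp_B {n : ℕ} {f g : A} (hf : HasArity n 1 f) (hg : HasArity n 1 g)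
    (h : f ⊚ B = g ⊚ B) : f = g := by
  -- Currying only looks at the value at `I`, and `f ⊚ B` has the same value there as f because `B ⬝
  -- I = I`.
  have key : ∀ {f : A}, HasArity n 1 f → f = curry n (f ⊚ B) := by
    intro f hf
    have e : (f ⊚ B) ⬝ I = f ⬝ I := by rw [comp_app, lam]
    unfold curry
    rw [e, hf.eq_dot_comp]
  rw [key hf, h, ← key hg]

theorem eq_of_comp_npow_B {n k : ℕ} {f g : A} (hf : HasArity n 1 f) (hg : HasArity n 1 g)
    (h : f ⊚ npow B k = g ⊚ npow B k) : f = g := by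
  induction k with
  | zero => rwa [npow_nil, comp_I, comp_I] at h
  | succ k ih =>
    rw [npow_step', ← comp_assoc, ← comp_assoc] at h
    apply ih
    have hB := fun {f : A} (hf : HasArity n 1 f) =>
      (Nat.add_comm 1 k ▸ hf.add_right k).comp (hasArity_npow_B k)
    exact eq_of_comp_B (hB hf) (hB hg) h

/-- Elements are determined by the corresponding global elements applied to `k` arguments. -/
theorem eq_of_dot_comp_npow_B {k : ℕ} {f g : A} (h : dot f ⊚ npow B k = dot g ⊚ npow B k) :
    f = g :=
  dot_injective (eq_of_comp_npow_B (hasArity_dot f) (hasArity_dot g) h)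

/-- Elements of the same arity `m → n` are equal if they agree after `n` applications. -/
theorem eq_of_B_comp_npow_B {m n : ℕ} {f g : A} (hf : HasArity m n f) (hg : HasArity m n g)
    (h : (B ⬝ f) ⊚ npow B n = (B ⬝ g) ⊚ npow B n) : f = g := by
  rw [← hf, ← hg] at h
  exact eq_of_dot_comp_npow_B h

/-! ### Naturality of the braiding -/

/-- The two signs agree on two arguments (`C_two`), so this is the cancellation C⁻ (C⁺ x) = x. -/
theorem dot_comp_C (a x : A) : dot a ⊚ (Cp ⬝ x) = x ⬝ a := by
  have h := congrArg (fun z : A => z ⬝ x ⬝ a) (cox₁_neg (A := A))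
  simp only [comp_app, lam, I_app] at h
  rw [← C_eq, C_two, h]

theorem B_comp_C (x : A) : B ⊚ (Cp ⬝ x) = Cp ⬝ (Cp ⊚ (B ⬝ x)) := by
  have h := congrArg (fun z : A => z ⬝ x) (bc_pos (A := A))
  simp only [comp_app] at h
  exact h

theorem dot_comp_Cm_app (a x : A) : dot a ⊚ (Cm ⬝ x) = x ⬝ a := by
  have h := congrArg (fun z : A => z ⬝ x ⬝ a) (cox₁_pos (A := A))
  simp only [comp_app, lam, I_app] at h
  rw [← C_eq, h]

theorem B_comp_Cm_app (x : A) : B ⊚ (Cm ⬝ x) = Cm ⬝ (Cm ⊚ (B ⬝ x)) := by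
  have h := congrArg (fun z : A => z ⬝ x) (bc_neg (A := A))
  simp only [comp_app] at h
  exact h

theorem slide_Cm (a x : A) : (B ⬝ a) ⊚ (Cm ⬝ x) = Cm ⬝ ((B ⬝ a) ⊚ x) := by
  have h := congrArg (fun z : A => z ⬝ a ⬝ x) (cox₂_neg (A := A))
  simp only [comp_app, C_app, B_app] at h
  exact h

/-- The inverse of `σ_{n,1}`. -/
def sigmaOneInv : ℕ → A
  | 0 => I
  | m + 1 => Cm ⊚ (B ⬝ sigmaOneInv m)

/-- The inverse of `σ_{m,n}`. -/
def sigmaInv (m : ℕ) : ℕ → A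
  | 0 => I
  | n + 1 => (B ⬝ sigmaInv m n) ⊚ sigmaOneInv m

theorem sigmaOne_one : sigmaOne 1 = (Cp : A) := by
  simp only [sigmaOne, lam, I_comp]

theorem sigma_one_succ (n : ℕ) : sigma 1 (n + 1) = (Cp : A) ⊚ (B ⬝ sigma 1 n) := by
  simp only [sigma, sigmaOne_one]

theorem sigma_one_right (m : ℕ) : sigma m 1 = (sigmaOne m : A) := by
  simp only [sigma, lam, comp_I]

theorem sigma_zero_right (m : ℕ) : sigma m 0 = (I : A) := rfl

theorem sigma_one_one : sigma 1 1 = (Cp : A) := by rw [sigma_one_right, sigmaOne_one]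

theorem sigma_one_two : sigma 1 2 = (Cp : A) ⊚ (B ⬝ Cp) := by
  rw [sigma_one_succ, sigma_one_one]

theorem sigma_succ_one (m : ℕ) : sigma (m + 1) 1 = (B ⬝ sigma m 1) ⊚ (Cp : A) := by
  rw [sigma_one_right, sigma_one_right]; rfl

theorem sigma_two_one : sigma 2 1 = (B ⬝ Cp) ⊚ (Cp : A) := by
  rw [sigma_succ_one, sigma_one_one]

theorem sigma_zero_left (n : ℕ) : sigma 0 n = (I : A) := by
  induction n with
  | zero => rfl
  | succ n ih => simp only [sigma, ih, lam, comp_I, sigmaOne]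

/-- Each `B` moved past contributes one crossing (`B_comp_C`). This is how a composite of
applications produces a braiding. -/
theorem npow_B_comp_C (n : ℕ) : npow B n ⊚ (Cp ⬝ I) = Cp ⬝ (sigma 1 n : A) := by
  induction n with
  | zero => simp only [npow_nil, I_comp, sigma]
  | succ n ih => rw [npow_step, comp_assoc, ih, B_comp_C, sigma_one_succ]

theorem npow_B_comp_Cm (n : ℕ) : npow B n ⊚ (Cm ⬝ I) = Cm ⬝ (sigmaOneInv n : A) := by
  induction n with
  | zero => simp only [npow_nil, I_comp, sigmaOneInv]
  | succ n ih => rw [npow_step, comp_assoc, ih, B_comp_Cm_app, sigmaOneInv]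

theorem C_injective {x y : A} (h : Cp ⬝ x = Cp ⬝ y) : x = y := by
  have h' := congrArg (fun z : A => Cm ⬝ z) h
  simp only [← comp_app, Cm_C, I_app] at h'
  exact h'

theorem Cm_injective {x y : A} (h : Cm ⬝ x = Cm ⬝ y) : x = y := by
  have h' := congrArg (fun z : A => Cp ⬝ z) h
  simp only [← comp_app, C_Cm, I_app] at h'
  exact h'

/-- The arity equation followed by `Cp ⬝ I`: both sides become `Cp` applied to a side of the square,
and `Cp` is injective. -/
theorem sigma_one_naturality {m n : ℕ} {a : A} (h : HasArity m n a) :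
    (B ⬝ a) ⊚ sigma 1 n = sigma 1 m ⊚ a := by
  have h' := congrArg (fun z : A => z ⊚ (Cp ⬝ I)) h
  simp only [comp_assoc, npow_step, npow_B_comp_C, slide_C, B_comp_C, dot_comp_C] at h'
  rw [comp_app] at h'
  exact (C_injective h').symm

/-- The same argument with the negative crossing. Inverting the result gives naturality of σ_{n,1},
the other half needed for the braiding. -/
theorem sigmaOneInv_naturality {m n : ℕ} {a : A} (h : HasArity m n a) :
    (B ⬝ a) ⊚ sigmaOneInv n = sigmaOneInv m ⊚ a := by
  have h' := congrArg (fun z : A => z ⊚ (Cm ⬝ I)) h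
  simp only [comp_assoc, npow_step, npow_B_comp_Cm, slide_Cm, B_comp_Cm_app, dot_comp_Cm_app] at h'
  rw [comp_app] at h'
  exact (Cm_injective h').symm

theorem sigmaOne_comp_inv (m : ℕ) : sigmaOne m ⊚ sigmaOneInv m = (I : A) := by
  induction m with
  | zero => exact I_comp _
  | succ m ih =>
    rw [sigmaOne, sigmaOneInv, comp_assoc, ← comp_assoc Cp, C_Cm, I_comp, B_congr ih, lam]

theorem sigmaOneInv_comp (m : ℕ) : sigmaOneInv m ⊚ sigmaOne m = (I : A) := by
  induction m with
  | zero => exact I_comp _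
  | succ m ih =>
    rw [sigmaOne, sigmaOneInv, comp_assoc, ← comp_assoc (B ⬝ sigmaOneInv m), B_congr ih, lam,
      I_comp, Cm_C]

theorem sigma_comp_inv (m n : ℕ) : sigma m n ⊚ sigmaInv m n = (I : A) := by
  induction n with
  | zero => exact I_comp _
  | succ n ih =>
    rw [sigma, sigmaInv, comp_assoc, ← comp_assoc (B ⬝ sigma m n), B_congr ih, lam, I_comp,
      sigmaOne_comp_inv]

theorem sigmaInv_comp (m n : ℕ) : sigmaInv m n ⊚ sigma m n = (I : A) := by
  induction n with
  | zero => exact I_comp _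
  | succ n ih =>
    rw [sigma, sigmaInv, comp_assoc, ← comp_assoc (sigmaOneInv m), sigmaOneInv_comp, I_comp,
      B_congr ih, lam]

theorem hasArity_sigmaOne (m : ℕ) : HasArity (m + 1) (1 + m) (sigmaOne m : A) := by
  induction m with
  | zero => exact hasArity_I 1
  | succ m ih =>
    have h := (hasArity_Cp (A := A)).add_right m
    rw [show 2 + m = 1 + m + 1 by omega] at h
    have h' := ih.B_app.comp h
    rw [sigmaOne, show 1 + (m + 1) = 1 + m + 1 by omega]
    exact h'

theorem hasArity_sigmaOneInv (m : ℕ) : HasArity (1 + m) (m + 1) (sigmaOneInv m : A) := by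
  induction m with
  | zero => exact hasArity_I 1
  | succ m ih =>
    have h := (hasArity_Cm (A := A)).add_right m
    rw [show 2 + m = 1 + m + 1 by omega] at h
    have h' := h.comp ih.B_app
    rw [sigmaOneInv, show 1 + (m + 1) = 1 + m + 1 by omega]
    exact h'

theorem hasArity_sigma (m n : ℕ) : HasArity (m + n) (n + m) (sigma m n : A) := by
  induction n with
  | zero => rw [Nat.add_zero, Nat.zero_add]; exact hasArity_I m
  | succ n ih =>
    have h := (hasArity_sigmaOne (A := A) m).add_right n
    have h' := ih.B_app
    rw [show m + 1 + n = m + (n + 1) by omega, show 1 + m + n = m + n + 1 by omega] at h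
    rw [show n + m + 1 = n + 1 + m by omega] at h'
    exact h.comp h'

theorem hasArity_sigmaInv (m n : ℕ) : HasArity (n + m) (m + n) (sigmaInv m n : A) := by
  induction n with
  | zero => rw [Nat.add_zero, Nat.zero_add]; exact hasArity_I m
  | succ n ih =>
    have h := (hasArity_sigmaOneInv (A := A) m).add_right n
    have h' := ih.B_app
    rw [show m + 1 + n = m + (n + 1) by omega, show 1 + m + n = m + n + 1 by omega] at h
    rw [show n + m + 1 = n + 1 + m by omega] at h'
    exact h'.comp h

theorem sigmaOne_naturality {m n : ℕ} {a : A} (h : HasArity m n a) :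
    a ⊚ sigmaOne n = sigmaOne m ⊚ (B ⬝ a) := by
  have h' := sigmaOneInv_naturality h
  calc a ⊚ sigmaOne n = sigmaOne m ⊚ (sigmaOneInv m ⊚ a) ⊚ sigmaOne n := by
        rw [comp_assoc, ← comp_assoc (sigmaOne m), sigmaOne_comp_inv, I_comp]
    _ = sigmaOne m ⊚ (B ⬝ a) := by rw [← h', comp_assoc, sigmaOneInv_comp, comp_I]

theorem sigma_naturality_left {m n : ℕ} {a : A} (h : HasArity m n a) (l : ℕ) :
    a ⊚ sigma n l = sigma m l ⊚ (npow B l ⬝ a) := by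
  induction l with
  | zero => rw [sigma, sigma, comp_I, I_comp, npow_nil, I_app]
  | succ l ih =>
    rw [sigma, sigma, ← comp_assoc, sigmaOne_naturality h, comp_assoc, B_congr ih, comp_assoc,
      B_comp, npow_B_succ]

theorem sigma_add_right (m n k : ℕ) :
    sigma m (n + k) = sigma m n ⊚ (npow B n ⬝ (sigma m k : A)) := by
  induction n with
  | zero => rw [Nat.zero_add, sigma, I_comp, npow_nil, I_app]
  | succ n ih =>
    rw [Nat.succ_add, sigma, ih, sigma, npow_B_succ, B_comp, comp_assoc]

theorem sigmaOne_add (m k : ℕ) :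
    sigmaOne (m + k) = (npow B m ⬝ (sigmaOne k : A)) ⊚ sigmaOne m := by
  induction m with
  | zero => rw [Nat.zero_add, sigmaOne, comp_I, npow_nil, I_app]
  | succ m ih => rw [Nat.succ_add, sigmaOne, ih, B_comp, npow_B_succ, comp_assoc, sigmaOne]

theorem sigma_add_left (m k n : ℕ) :
    sigma (m + k) n = (npow B m ⬝ (sigma k n : A)) ⊚ sigma m n := by
  induction n with
  | zero => simp only [sigma, npow_B_I, I_comp]
  | succ n ih =>
    have h := (hasArity_sigmaOne (A := A) m).interchange (sigma k n)
    rw [Nat.add_comm 1 m] at h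
    simp only [sigma, ih, sigmaOne_add, npow_B_comp, B_comp, comp_assoc]
    rw [← npow_B_succ, comp_eq_assoc h.symm, comp_assoc, npow_step', comp_app]

theorem sigma_naturality_right {m n : ℕ} {a : A} (h : HasArity m n a) (l : ℕ) :
    (npow B l ⬝ a) ⊚ sigma l n = sigma l m ⊚ a := by
  induction l with
  | zero => rw [sigma_zero_left, sigma_zero_left, comp_I, I_comp, npow_nil, I_app]
  | succ l ih =>
    rw [sigma_add_left l 1, sigma_add_left l 1, npow_step', comp_app, comp_assoc, ← ih,
      ← comp_assoc, ← comp_assoc, ← npow_B_comp, ← npow_B_comp, sigma_one_naturality h]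

/-! ### The twist -/

theorem theta_comp_inv : (θp : A) ⊚ θm = I := by rw [theta₂_pos, lam]

theorem theta_inv_comp : (θm : A) ⊚ θp = I := by rw [theta₂_neg, lam]

theorem hasArity_θp : HasArity 1 1 (θp : A) := by
  have h := theta₁_pos (A := A)
  rw [C_eq, comp_assoc] at h
  simpa only [HasArity, npow_step, npow_nil, comp_I] using h.symm

theorem hasArity_θm : HasArity 1 1 (θm : A) := by
  have h := theta₁_neg (A := A)
  rw [C_eq, comp_assoc] at h
  simpa only [HasArity, npow_step, npow_nil, comp_I] using h.symm

theorem dot_comp_θp (a : A) : dot a ⊚ θp = dot a := by rw [← C_eq, theta₃_pos]; rfl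

theorem theta_one : theta 1 = (θp : A) := by
  rw [theta, theta, sigma_zero_left, sigma_zero_right, comp_I, comp_I, comp_I]

theorem theta_two : theta 2 = (θp : A) ⊚ Cp ⊚ θp ⊚ Cp := by
  rw [theta, theta_one, sigma_one_one]

theorem hasArity_theta (m : ℕ) : HasArity m m (theta m : A) := by
  induction m with
  | zero => exact hasArity_I 0
  | succ m ih =>
    have h1 := (hasArity_θp (A := A)).add_right m
    have h2 := ih.add_right 1
    have h3 := hasArity_sigma (A := A) 1 m
    have h4 := hasArity_sigma (A := A) m 1
    rw [Nat.add_comm 1 m] at h1 h3 h4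
    exact h1.comp (h3.comp (h2.comp h4))

/-- The definition of `theta` peels off one strand at a time. For blocks, interchange moves the
crossings past the twists so that they join larger braidings, and naturality carries σ_{m,1} back
past the n-strand block. -/
theorem theta_add (m n : ℕ) :
    theta (m + n) = theta m ⊚ sigma m n ⊚ theta n ⊚ (sigma n m : A) := by
  induction m with
  | zero => simp only [theta, Nat.zero_add, sigma_zero_left, sigma_zero_right, I_comp, comp_I]
  | succ m ih =>
    have h1 := (hasArity_theta (A := A) m).interchange (sigma 1 n)
    have h2 := (hasArity_theta (A := A) n).interchange (sigma m 1)
    have h3 := sigma_naturality_right (hasArity_sigma (A := A) m 1) n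
    have h4 := sigma_naturality_left (hasArity_sigma (A := A) m 1) n
    rw [Nat.add_comm 1 m] at h3 h4
    calc theta (m + 1 + n) = theta (m + n + 1) := by rw [Nat.add_right_comm]
      _ = θp ⊚ sigma 1 m ⊚ ((npow B m ⬝ sigma 1 n) ⊚ theta m) ⊚ sigma m n ⊚ theta n ⊚
          sigma n m ⊚ (npow B m ⬝ sigma n 1) ⊚ sigma m 1 := by
        rw [theta, ih, sigma_add_right, sigma_add_left]; simp only [comp_assoc]
      _ = θp ⊚ sigma 1 m ⊚ theta m ⊚ sigma (m + 1) n ⊚ theta n ⊚ (sigma n (m + 1)) ⊚ sigma m 1 := by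
        rw [h1, sigma_add_left m 1, sigma_add_right n m 1]; simp only [comp_assoc]
      _ = θp ⊚ sigma 1 m ⊚ theta m ⊚ sigma (m + 1) n ⊚ (theta n ⊚ (npow B n ⬝ sigma m 1)) ⊚
          sigma n (m + 1) := by rw [← h3, comp_assoc]
      _ = θp ⊚ sigma 1 m ⊚ theta m ⊚ (sigma (m + 1) n ⊚ (npow B n ⬝ sigma m 1)) ⊚ theta n ⊚
          sigma n (m + 1) := by rw [← h2]; simp only [comp_assoc]
      _ = _ := by rw [← h4, theta]; simp only [comp_assoc]

/-- `B` is natural for the twist. -/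
theorem B_comp_θp : (B : A) ⊚ θp = theta 2 ⊚ B := by
  rw [theta_two]; simpa only [comp_assoc] using theta₄_pos (A := A)

/-- Twist-naturality is stable under adding inert wires on the right. -/
theorem twist_naturality_add_right {m n : ℕ} {a : A} (ha : HasArity m n a)
    (h : a ⊚ theta n = theta m ⊚ a) (k : ℕ) : a ⊚ theta (n + k) = theta (m + k) ⊚ a := by
  rw [theta_add, theta_add, ← comp_assoc a, h]
  simp only [comp_assoc]
  rw [comp_eq_assoc (sigma_naturality_left ha k), ← sigma_naturality_right ha k,
    comp_assoc, comp_eq_assoc ((hasArity_theta (A := A) k).interchange a), comp_assoc]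

theorem npow_B_comp_θp (k : ℕ) : npow B k ⊚ θp = theta (k + 1) ⊚ npow (B : A) k := by
  induction k with
  | zero => rw [theta_one, npow_nil, I_comp, comp_I]
  | succ k ih =>
    have h := twist_naturality_add_right hasArity_B (A := A) (by rw [theta_one, B_comp_θp]) k
    rw [npow_step, comp_assoc, ih, ← comp_assoc, Nat.add_comm k 1, h, comp_assoc,
      show 2 + k = 1 + k + 1 by omega]

/-- A point absorbs the twist by the axiom `theta₃_pos`; inert wires are then added. -/
theorem dot_comp_theta (a : A) (k : ℕ) : dot a ⊚ theta (k + 1) = theta k ⊚ dot a := by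
  have h := twist_naturality_add_right (hasArity_dot a)
    (by rw [theta_one, dot_comp_θp, theta, I_comp]) k
  rwa [Nat.add_comm 1 k, Nat.zero_add] at h

/-- The inverse of `θ_m`. -/
def thetaInv : ℕ → A
  | 0 => I
  | m + 1 => sigmaInv m 1 ⊚ thetaInv m ⊚ sigmaInv 1 m ⊚ θm

theorem thetaInv_one : thetaInv 1 = (θm : A) := by
  simp only [thetaInv, sigmaInv, sigmaOneInv, lam, I_comp]

theorem theta_comp_thetaInv (m : ℕ) : theta m ⊚ thetaInv m = (I : A) := by
  induction m with
  | zero => exact I_comp _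
  | succ m ih =>
    simp only [theta, thetaInv, comp_assoc]
    rw [comp_eq_assoc (sigma_comp_inv m 1), I_comp, comp_eq_assoc ih, I_comp,
      comp_eq_assoc (sigma_comp_inv 1 m), I_comp, theta_comp_inv]

theorem thetaInv_comp_theta (m : ℕ) : thetaInv m ⊚ theta m = (I : A) := by
  induction m with
  | zero => exact I_comp _
  | succ m ih =>
    simp only [theta, thetaInv, comp_assoc]
    rw [comp_eq_assoc theta_inv_comp, I_comp, comp_eq_assoc (sigmaInv_comp 1 m), I_comp,
      comp_eq_assoc ih, I_comp, sigmaInv_comp]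

theorem hasArity_thetaInv (m : ℕ) : HasArity m m (thetaInv m : A) := by
  induction m with
  | zero => exact hasArity_I 0
  | succ m ih =>
    have h1 := (hasArity_θm (A := A)).add_right m
    have h2 := ih.add_right 1
    have h3 := hasArity_sigmaInv (A := A) 1 m
    have h4 := hasArity_sigmaInv (A := A) m 1
    rw [Nat.add_comm 1 m] at h1 h3 h4
    exact h4.comp (h2.comp (h3.comp h1))

/-- Points and `B` are natural for the twist by axiom, and the arity equation expresses a through
them. Following that equation by `θp` transfers naturality to a. -/
theorem theta_naturality {m n : ℕ} {a : A} (h : HasArity m n a) :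
    a ⊚ theta n = theta m ⊚ a := by
  -- `S k` twists the continuation strand and winds it once around the other k; it is the part of
  -- θ_{k+1} besides θ_k, and it is invertible.
  obtain ⟨S, hS⟩ : ∃ S : ℕ → A, S = fun k => θp ⊚ sigma 1 k ⊚ sigma k 1 := ⟨_, rfl⟩
  have hθ : ∀ k, theta (k + 1) = S k ⊚ (B ⬝ (theta k : A)) := by
    intro k
    have e := sigma_naturality_left (hasArity_theta (A := A) k) 1
    rw [npow_step, npow_nil, comp_I] at e
    rw [theta, e]; simp only [hS, comp_assoc]
  have hSa : (B ⬝ a) ⊚ S n = S m ⊚ (B ⬝ a) := by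
    have e := sigma_naturality_left h 1
    have e' := hasArity_θp (A := A).interchange a
    rw [npow_step, npow_nil, comp_I] at e e'
    simp only [hS]
    rw [comp_eq_assoc e', comp_assoc, comp_eq_assoc (sigma_one_naturality h), comp_assoc, e]
    simp only [comp_assoc]
  have key := congrArg (fun z : A => z ⊚ θp) h
  simp only [comp_assoc] at key
  rw [npow_B_comp_θp, npow_B_comp_θp, ← comp_assoc, dot_comp_theta, comp_assoc, h, hθ, hθ] at key
  simp only [comp_assoc] at key
  rw [comp_eq_assoc hSa, comp_assoc] at key
  have hinv : ∃ T : A, T ⊚ S m = I := by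
    refine ⟨sigmaInv m 1 ⊚ sigmaInv 1 m ⊚ θm, ?_⟩
    simp only [hS, comp_assoc]
    rw [comp_eq_assoc theta_inv_comp, I_comp, comp_eq_assoc (sigmaInv_comp 1 m), I_comp,
      sigmaInv_comp]
  obtain ⟨T, hT⟩ := hinv
  have key' := congrArg (fun z : A => T ⊚ z) key
  simp only [comp_eq_assoc hT, I_comp] at key'
  refine (eq_of_B_comp_npow_B ((hasArity_theta m).comp h) (h.comp (hasArity_theta n)) ?_).symm
  simpa only [B_comp, comp_assoc] using key'

theorem theta_add_tensor (m n : ℕ) :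
    theta (m + n) = sigma m n ⊚ (theta n ⊚ (npow B n ⬝ theta m)) ⊚ (sigma n m : A) := by
  have h := (hasArity_theta (A := A) n).interchange (theta m)
  rw [theta_add, ← h, comp_assoc,
    comp_eq_assoc (sigma_naturality_left (hasArity_theta (A := A) m) n).symm, comp_assoc]

/-! ### Naturality of the braiding in small arities -/

theorem sigmaInv_one_naturality {m n : ℕ} {a : A} (h : HasArity m n a) :
    a ⊚ sigmaInv 1 n = sigmaInv 1 m ⊚ (B ⬝ a) := by
  calc a ⊚ sigmaInv 1 n = sigmaInv 1 m ⊚ (sigma 1 m ⊚ a) ⊚ sigmaInv 1 n := by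
        rw [comp_assoc, comp_eq_assoc (sigmaInv_comp 1 m), I_comp]
    _ = sigmaInv 1 m ⊚ (B ⬝ a) := by
        rw [← sigma_one_naturality h, comp_assoc, sigma_comp_inv, comp_I]

theorem sigmaOneInv_one : sigmaOneInv 1 = (Cm : A) := by
  rw [sigmaOneInv, sigmaOneInv, lam, comp_I]

theorem sigmaOneInv_two : sigmaOneInv 2 = (Cm : A) ⊚ (B ⬝ Cm) := by
  rw [sigmaOneInv, sigmaOneInv_one]

theorem sigmaInv_zero_right (m : ℕ) : sigmaInv m 0 = (I : A) := rfl

theorem sigmaInv_one_one : sigmaInv 1 1 = (Cm : A) := by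
  rw [sigmaInv, sigmaInv, lam, I_comp, sigmaOneInv_one]

theorem sigmaInv_one_two : sigmaInv 1 2 = (B ⬝ Cm) ⊚ (Cm : A) := by
  rw [sigmaInv, sigmaInv_one_one, sigmaOneInv_one]

section Naturality

variable {a : A}

theorem _root_.RibbonSignature.HasArity.comp_Cp (h : HasArity 1 1 a) : a ⊚ Cp = Cp ⊚ (B ⬝ a) := by
  simpa only [sigmaOne_one] using sigmaOne_naturality h

theorem _root_.RibbonSignature.HasArity.comp_Cm (h : HasArity 1 1 a) : a ⊚ Cm = Cm ⊚ (B ⬝ a) := by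
  simpa only [sigmaInv_one_one] using sigmaInv_one_naturality h

theorem _root_.RibbonSignature.HasArity.B_comp_Cp (h : HasArity 1 1 a) :
    (B ⬝ a) ⊚ Cp = Cp ⊚ a := by
  simpa only [sigma_one_one] using sigma_one_naturality h

theorem _root_.RibbonSignature.HasArity.B_comp_Cm (h : HasArity 1 1 a) :
    (B ⬝ a) ⊚ Cm = Cm ⊚ a := by
  simpa only [sigmaOneInv_one] using sigmaOneInv_naturality h

theorem _root_.RibbonSignature.HasArity.dup_comp_Cp (h : HasArity 1 2 a) :
    a ⊚ (B ⬝ Cp) ⊚ Cp = Cp ⊚ (B ⬝ a) := by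
  simpa only [← sigma_one_right, sigma_two_one, sigma_one_one] using sigmaOne_naturality h

theorem _root_.RibbonSignature.HasArity.dup_comp_Cm (h : HasArity 1 2 a) :
    a ⊚ (B ⬝ Cm) ⊚ Cm = Cm ⊚ (B ⬝ a) := by
  simpa only [sigmaInv_one_one, sigmaInv_one_two] using sigmaInv_one_naturality h

theorem _root_.RibbonSignature.HasArity.B_dup_comp_Cm (h : HasArity 1 2 a) :
    (B ⬝ a) ⊚ Cm ⊚ (B ⬝ Cm) = Cm ⊚ a := by
  simpa only [sigmaOneInv_one, sigmaOneInv_two] using sigmaOneInv_naturality h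

theorem _root_.RibbonSignature.HasArity.pair_comp_Cm (h : HasArity 0 2 a) :
    a ⊚ (B ⬝ Cm) ⊚ Cm = B ⬝ a := by
  simpa only [sigmaInv_zero_right, sigmaInv_one_two, comp_assoc, I_comp]
    using sigmaInv_one_naturality h

theorem _root_.RibbonSignature.HasArity.B_pair_comp_Cp (h : HasArity 0 2 a) :
    (B ⬝ a) ⊚ Cp = a ⊚ (B ⬝ Cm) := by
  rw [← h.pair_comp_Cm, comp_assoc, comp_assoc, Cm_C, comp_I]

theorem _root_.RibbonSignature.HasArity.op_comp_Cp (h : HasArity 2 1 a) :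
    a ⊚ Cp = (B ⬝ Cp) ⊚ Cp ⊚ (B ⬝ a) := by
  have e := sigmaOne_naturality h
  simp only [← sigma_one_right, sigma_two_one, sigma_one_one] at e
  rw [e, comp_assoc]

theorem _root_.RibbonSignature.HasArity.op_comp_Cm (h : HasArity 2 1 a) :
    a ⊚ Cm = (B ⬝ Cm) ⊚ Cm ⊚ (B ⬝ a) := by
  have e := sigmaInv_one_naturality h
  rw [sigmaInv_one_one, sigmaInv_one_two, comp_assoc] at e
  exact e

theorem npow_B_two_app (x : A) : npow B 2 ⬝ x = B ⬝ (B ⬝ x) := by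
  rw [npow_step, npow_step, npow_nil, comp_I, comp_app]

theorem npow_B_one_app (x : A) : npow B 1 ⬝ x = B ⬝ x := by
  rw [npow_step, npow_nil, comp_I]

theorem _root_.RibbonSignature.HasArity.interchange₂₁ (h : HasArity 2 1 a) (x : A) :
    (B ⬝ (B ⬝ x)) ⊚ a = a ⊚ (B ⬝ x) := by
  simpa only [npow_B_two_app, npow_B_one_app] using h.interchange x

theorem _root_.RibbonSignature.HasArity.interchange₁₂ (h : HasArity 1 2 a) (x : A) :
    (B ⬝ x) ⊚ a = a ⊚ (B ⬝ (B ⬝ x)) := by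
  simpa only [npow_B_two_app, npow_B_one_app] using h.interchange x

theorem _root_.RibbonSignature.HasArity.interchange₁₁ (h : HasArity 1 1 a) (x : A) :
    (B ⬝ x) ⊚ a = a ⊚ (B ⬝ x) := by
  simpa only [npow_B_two_app, npow_B_one_app] using h.interchange x

theorem _root_.RibbonSignature.HasArity.interchange₂₂ (h : HasArity 2 2 a) (x : A) :
    (B ⬝ (B ⬝ x)) ⊚ a = a ⊚ (B ⬝ (B ⬝ x)) := by
  simpa only [npow_B_two_app, npow_B_one_app] using h.interchange x

theorem _root_.RibbonSignature.HasArity.interchange₀₂ (h : HasArity 0 2 a) (x : A) :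
    x ⊚ a = a ⊚ (B ⬝ (B ⬝ x)) := by
  simpa only [npow_B_two_app, npow_nil, I_app] using h.interchange x

theorem _root_.RibbonSignature.HasArity.interchange₂₀ (h : HasArity 2 0 a) (x : A) :
    (B ⬝ (B ⬝ x)) ⊚ a = a ⊚ x := by
  simpa only [npow_B_two_app, npow_nil, I_app] using h.interchange x

theorem _root_.RibbonSignature.HasArity.dot_comp_B (h : HasArity 1 1 a) :
    dot a ⊚ B ⊚ B = (B ⬝ a) ⊚ B := by
  simpa only [HasArity, npow_step, npow_nil, comp_I] using h

end Naturality

/-! ### Mixed-sign braid relations and the twist on two strands -/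

theorem braid_neg_pos_pos : (Cm : A) ⊚ (B ⬝ Cp) ⊚ Cp = (B ⬝ Cp) ⊚ Cp ⊚ (B ⬝ Cm) := by
  have h : (B ⬝ (Cp : A)) ⊚ Cp = Cm ⊚ (B ⬝ Cp) ⊚ Cp ⊚ (B ⬝ Cp) := by
    rw [cox₃_pos, ← comp_assoc Cm, Cm_C, I_comp]
  calc (Cm : A) ⊚ (B ⬝ Cp) ⊚ Cp = (Cm ⊚ (B ⬝ Cp) ⊚ Cp ⊚ (B ⬝ Cp)) ⊚ (B ⬝ Cm) := by
        simp only [comp_assoc]; rw [B_congr C_Cm, lam, comp_I]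
    _ = _ := by rw [← h, comp_assoc]

theorem braid_neg_neg_pos : (B ⬝ (Cm : A)) ⊚ Cm ⊚ (B ⬝ Cp) = Cp ⊚ (B ⬝ Cm) ⊚ Cm := by
  have h : (Cm : A) ⊚ (B ⬝ Cm) ⊚ Cm ⊚ (B ⬝ Cp) = (B ⬝ Cm) ⊚ Cm := by
    have := congrArg (fun z : A => z ⊚ (B ⬝ Cp)) (cox₃_neg (A := A))
    simp only [comp_assoc] at this
    rw [← this, B_congr Cm_C, lam, comp_I]
  rw [← h, ← comp_assoc Cp, C_Cm, I_comp]

theorem hexagon_B_neg : (B : A) ⊚ Cm = (B ⬝ Cm) ⊚ Cm ⊚ (B ⬝ B) := hasArity_B.op_comp_Cm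

theorem theta_two_eq : theta 2 = (θp : A) ⊚ (B ⬝ θp) ⊚ Cp ⊚ Cp := by
  rw [theta_two, ← comp_assoc Cp, ← hasArity_θp.B_comp_Cp, comp_assoc]

theorem B_comp_θp_eq : (B : A) ⊚ θp = θp ⊚ (B ⬝ θp) ⊚ Cp ⊚ Cp ⊚ B := by
  rw [B_comp_θp, theta_two_eq]; simp only [comp_assoc]

/-- The twist of the first factor of an application. -/
theorem θp_comp_B : (θp : A) ⊚ B = (B ⬝ θm) ⊚ Cm ⊚ Cm ⊚ B ⊚ θp := by
  rw [B_comp_θp_eq]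
  have e1 : ∀ x : A, Cm ⊚ θp ⊚ x = (B ⬝ θp) ⊚ Cm ⊚ x := fun x => by
    rw [← comp_assoc, ← hasArity_θp.B_comp_Cm, comp_assoc]
  have e2 : ∀ x : A, Cm ⊚ (B ⬝ θp) ⊚ x = θp ⊚ Cm ⊚ x := fun x => by
    rw [← comp_assoc, ← hasArity_θp.comp_Cm, comp_assoc]
  rw [e1, e2, e2, e1, comp_eq_assoc Cm_C, I_comp, comp_eq_assoc Cm_C, I_comp,
    comp_eq_assoc (hasArity_θp.interchange₁₁ θm), comp_assoc, comp_eq_assoc (B_congr theta_inv_comp),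
    lam, I_comp]

/-! ### The trace -/

theorem hasArity_Tr : HasArity 1 2 (Tr : A) := by
  have h := left_tightening (A := A)
  rw [C_eq, comp_assoc] at h
  simpa only [HasArity, npow_step, npow_nil, comp_I] using h

/-- The defining property of the trace `Tr ⬝ f` of an element `f`. -/
theorem B_Tr_app (f : A) : B ⬝ (Tr ⬝ f) = Tr ⊚ (B ⬝ f) ⊚ B := by
  have h := congrArg (fun z : A => z ⬝ f) (right_tightening (A := A))
  simp only [comp_app, C_app] at h
  exact h.symm

theorem Tr_comp_left (g f : A) : Tr ⬝ ((B ⬝ g) ⊚ f) = g ⊚ (Tr ⬝ f) := by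
  apply B_injective
  rw [B_Tr_app, B_comp, B_comp, B_Tr_app, comp_assoc,
    comp_eq_assoc (hasArity_Tr.interchange₁₂ g), comp_assoc]

theorem Tr_comp_right (f g : A) : Tr ⬝ (f ⊚ (B ⬝ g)) = (Tr ⬝ f) ⊚ g := by
  apply B_injective
  rw [B_Tr_app, B_comp, B_comp, B_Tr_app, comp_assoc, arity_B_slide]
  simp only [comp_assoc]

theorem Tr_comp_Cp_comp_B : Tr ⊚ (B ⬝ Cp) ⊚ B = B ⬝ (θp : A) := by rw [← B_Tr_app, yanking_pos]

theorem Tr_comp_Cm_comp_B : Tr ⊚ (B ⬝ Cm) ⊚ B = B ⬝ (θm : A) := by rw [← B_Tr_app, yanking_neg]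

theorem B_comp_Tr : B ⊚ Tr = (B ⬝ Tr) ⊚ dot (B : A) ⊚ B ⊚ B := by
  rw [← right_tightening, C_eq, comp_assoc]

/-- The arity of `Tr` feeds its two outputs to f, the arity of f rewrites the result, and `B_Tr_app`
reassembles the trace. -/
theorem _root_.RibbonSignature.HasArity.trace {m n : ℕ} {f : A} (h : HasArity (m + 1) (n + 1) f) :
    HasArity m n (Tr ⬝ f) := by
  have hT : dot (Tr : A) ⊚ B ⊚ B = (B ⬝ Tr) ⊚ B ⊚ B := by
    simpa only [HasArity, npow_step, npow_nil, comp_I] using hasArity_Tr (A := A)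
  unfold HasArity at *
  rw [dot_app, B_Tr_app, npow_step]
  simp only [comp_assoc]
  simp only [npow_step] at h
  rw [comp_eq_assoc₃ hT, ← h]
  simp only [comp_assoc]
  rw [← comp_assoc (dot f), ← comp_dot, comp_assoc]

/-! ### The cup `I ⊚ Tr` -/

/-- The element `dot I ⊚ Tr` of arity `0 → 2`. -/
def unitCup : A := dot I ⊚ Tr

/-- The flip `(x, y) ↦ C⁺ x y`. -/
def flipPos : A := dot Cp ⊚ B ⊚ B

/-- The flip `(x, y) ↦ C⁻ x y`. -/
def flipNeg : A := dot Cm ⊚ B ⊚ B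

theorem hasArity_unitCup : HasArity 0 2 (unitCup : A) := (hasArity_dot I).comp hasArity_Tr

theorem hasArity_flipPos : HasArity 2 1 (flipPos : A) := by
  have h := (hasArity_dot (Cp : A)).add_right 2
  exact h.comp ((hasArity_B.add_right 1).comp hasArity_B)

theorem hasArity_flipNeg : HasArity 2 1 (flipNeg : A) := by
  have h := (hasArity_dot (Cm : A)).add_right 2
  exact h.comp ((hasArity_B.add_right 1).comp hasArity_B)

theorem flipPos_comp_B : flipPos ⊚ B = (B ⬝ Cp) ⊚ B ⊚ (B : A) := by
  simpa only [HasArity, flipPos, npow_step, npow_nil, comp_I, comp_assoc] using hasArity_Cp (A := A)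

theorem flipNeg_comp_B : flipNeg ⊚ B = (B ⬝ Cm) ⊚ B ⊚ (B : A) := by
  simpa only [HasArity, flipNeg, npow_step, npow_nil, comp_I, comp_assoc] using hasArity_Cm (A := A)

theorem unitCup_comp_Cm_comp_B : unitCup ⊚ (B ⬝ Cm) ⊚ B = (θm : A) ⊚ dot I := by
  rw [unitCup, comp_assoc, Tr_comp_Cm_comp_B, comp_dot]

theorem unitCup_comp_Cp_comp_B : unitCup ⊚ (B ⬝ Cp) ⊚ B = (θp : A) ⊚ dot I := by
  rw [unitCup, comp_assoc, Tr_comp_Cp_comp_B, comp_dot]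

/-- Precomposition with `g`. -/
theorem hasArity_dot_comp_B (g : A) : HasArity 1 1 (dot g ⊚ B) :=
  ((hasArity_dot g).add_right 1).comp hasArity_B

/-- With (u₁, u₂) the legs of `unitCup`, the left side is y ↦ C⁻ u₁ (y u₂), which rebuilds y from
its value on u₂, up to precomposition with a twist. -/
theorem unitCup_comp_flipNeg :
    unitCup ⊚ (B ⬝ Cp) ⊚ (B ⬝ B) ⊚ flipNeg = dot (θm : A) ⊚ B := by
  refine eq_of_comp_B (n := 1) ?_ (hasArity_dot_comp_B θm) ?_
  · exact (hasArity_unitCup.add_right 1).comp (hasArity_Cp.B_app.comp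
      (hasArity_B.B_app.comp hasArity_flipNeg))
  · have hp : ∀ x : A, unitCup ⊚ (B ⬝ (B ⬝ x)) = x ⊚ unitCup := fun x =>
      (hasArity_unitCup.interchange₀₂ x).symm
    calc (unitCup ⊚ (B ⬝ Cp) ⊚ (B ⬝ B) ⊚ flipNeg) ⊚ (B : A)
        = unitCup ⊚ (B ⬝ Cp) ⊚ (B ⬝ (B ⊚ Cm)) ⊚ B ⊚ B := by
          simp only [B_comp, comp_assoc, flipNeg_comp_B]
      _ = unitCup ⊚ (B ⬝ (Cp ⊚ (B ⬝ Cm) ⊚ Cm)) ⊚ (B ⬝ (B ⬝ B)) ⊚ B ⊚ B := by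
          rw [hexagon_B_neg]; simp only [B_comp, comp_assoc]
      _ = unitCup ⊚ (B ⬝ (B ⬝ Cm)) ⊚ (B ⬝ Cm) ⊚ (B ⬝ (B ⬝ Cp)) ⊚ B ⊚ (B ⬝ B) ⊚ B := by
          rw [← braid_neg_neg_pos, comp_eq_assoc (arity_B_slide B)]; simp only [B_comp, comp_assoc]
      _ = Cm ⊚ (unitCup ⊚ (B ⬝ Cm) ⊚ B) ⊚ (B ⬝ Cp) ⊚ (B ⬝ B) ⊚ B := by
          rw [comp_eq_assoc (arity_B_slide Cp), comp_eq_assoc (hp Cm)]; simp only [comp_assoc]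
      _ = Cm ⊚ θm ⊚ Cp ⊚ B ⊚ dot I ⊚ B := by
          rw [unitCup_comp_Cm_comp_B]; simp only [comp_assoc]
          rw [comp_eq_assoc (comp_dot Cp I).symm, comp_assoc, comp_eq_assoc (comp_dot B I).symm,
            comp_assoc]
      _ = (B ⬝ θm) ⊚ B := by
          rw [dot_I_comp_B, comp_I, comp_eq_assoc hasArity_θm.comp_Cp, comp_assoc,
            comp_eq_assoc Cm_C, I_comp]
      _ = (dot θm ⊚ B) ⊚ B := by rw [comp_assoc, hasArity_θm.dot_comp_B]

/-- An element of arity `m → 2` can be recovered from the result of applying its first output to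
an additional input. -/
theorem recover_pair {m : ℕ} {q : A} (hq : HasArity m 2 q) :
    unitCup ⊚ (B ⬝ sigma 1 m) ⊚ (B ⬝ (q ⊚ (B ⬝ Cm) ⊚ B)) ⊚ flipNeg = q ⊚ dot θm ⊚ B := by
  have hp := (hasArity_unitCup.interchange₀₂ q).symm
  have h : sigma 1 m ⊚ q ⊚ (B ⬝ Cm) = (B ⬝ q) ⊚ Cp := by
    rw [← comp_assoc, ← sigma_one_naturality hq, sigma_one_two, comp_assoc, comp_assoc,
      B_congr C_Cm, lam, comp_I]
  calc _ = unitCup ⊚ (B ⬝ (sigma 1 m ⊚ q ⊚ (B ⬝ Cm))) ⊚ (B ⬝ B) ⊚ flipNeg := by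
        simp only [B_comp, comp_assoc]
    _ = q ⊚ unitCup ⊚ (B ⬝ Cp) ⊚ (B ⬝ B) ⊚ flipNeg := by
        rw [h, B_comp, comp_assoc, comp_eq_assoc hp, comp_assoc]
    _ = _ := by rw [unitCup_comp_flipNeg]

theorem R_θm_comp_R_θp : (dot θm ⊚ B) ⊚ dot θp ⊚ B = (I : A) := by
  refine eq_of_comp_B (n := 1) ((hasArity_dot_comp_B θm).comp (hasArity_dot_comp_B θp))
    (hasArity_I 1) ?_
  rw [comp_assoc, comp_assoc, comp_assoc, hasArity_θp.dot_comp_B, I_comp]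
  rw [← comp_assoc B, ← arity_B_slide, comp_assoc, ← comp_assoc, ← comp_dot, comp_assoc,
    hasArity_θm.dot_comp_B, ← comp_assoc, B_congr theta_comp_inv, lam, I_comp]

/-- Elements of arity `m → 2` are determined by applying their first output to an input. -/
theorem pair_ext {m : ℕ} {q q' : A} (hq : HasArity m 2 q) (hq' : HasArity m 2 q')
    (h : q ⊚ (B ⬝ Cm) ⊚ B = q' ⊚ (B ⬝ Cm) ⊚ B) : q = q' := by
  have e := recover_pair hq
  rw [h, recover_pair hq'] at e
  have e' := congrArg (fun z : A => z ⊚ dot θp ⊚ B) e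
  simpa only [comp_assoc, comp_I, (show dot θm ⊚ B ⊚ dot θp ⊚ B = (I : A) by
    rw [← R_θm_comp_R_θp, comp_assoc])] using e'.symm

/-! ### Self-duality of the generating object -/

theorem B_Tr_comp_Cm : (B ⬝ Tr) ⊚ (Cm : A) = Cm ⊚ Tr ⊚ (B ⬝ Cp) := by
  rw [← comp_assoc, ← hasArity_Tr.B_dup_comp_Cm]
  simp only [comp_assoc]
  rw [B_congr Cm_C, lam, comp_I]

/-- Opening the twist by `θp_comp_B` creates a double crossing; naturality pulls it through `Tr`,
and yanking yields a twist that cancels the remaining one. -/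
theorem Tr_comp_θp : Tr ⊚ θp ⊚ (B ⬝ Cm) ⊚ B = (Cm : A) ⊚ Cm ⊚ θp := by
  calc Tr ⊚ θp ⊚ (B ⬝ Cm) ⊚ (B : A)
      = Tr ⊚ (B ⬝ Cm) ⊚ (B ⬝ θm) ⊚ Cm ⊚ Cm ⊚ B ⊚ θp := by
        rw [comp_eq_assoc (hasArity_θp.interchange₁₁ Cm).symm, comp_assoc, θp_comp_B]
    _ = (Tr ⊚ (B ⬝ (B ⬝ θm))) ⊚ (B ⬝ Cm) ⊚ Cm ⊚ Cm ⊚ B ⊚ θp := by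
        rw [comp_assoc, comp_eq_assoc (B_congr hasArity_θm.B_comp_Cm), B_comp, comp_assoc]
    _ = (B ⬝ θm) ⊚ (Tr ⊚ (B ⬝ Cm) ⊚ Cm) ⊚ Cm ⊚ B ⊚ θp := by
        rw [← hasArity_Tr.interchange₁₂]; simp only [comp_assoc]
    _ = (B ⬝ θm) ⊚ Cm ⊚ ((B ⬝ Tr) ⊚ Cm) ⊚ B ⊚ θp := by
        rw [hasArity_Tr.dup_comp_Cm]; simp only [comp_assoc]
    _ = (B ⬝ θm) ⊚ Cm ⊚ Cm ⊚ (Tr ⊚ (B ⬝ Cp) ⊚ B) ⊚ θp := by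
        rw [B_Tr_comp_Cm]; simp only [comp_assoc]
    _ = (B ⬝ θm) ⊚ (B ⬝ θp) ⊚ Cm ⊚ Cm ⊚ θp := by
        rw [Tr_comp_Cp_comp_B, comp_eq_assoc hasArity_θp.comp_Cm.symm, comp_assoc,
          comp_eq_assoc hasArity_θp.B_comp_Cm.symm, comp_assoc]
    _ = Cm ⊚ Cm ⊚ θp := by rw [comp_eq_assoc (B_congr theta_inv_comp), lam, I_comp]

/-- By `pair_ext`, both sides are tested by applying the first leg to an input; each test gives `dot
I`. -/
theorem unitCup_comp_θp : unitCup ⊚ θp = unitCup ⊚ (B ⬝ (θp : A)) := by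
  refine pair_ext (hasArity_unitCup.comp (hasArity_θp.add_right 1))
    (hasArity_unitCup.comp hasArity_θp.B_app) ?_
  have h1 : (unitCup ⊚ θp) ⊚ (B ⬝ Cm) ⊚ B = dot (I : A) := by
    rw [unitCup, comp_assoc, comp_assoc, Tr_comp_θp, comp_eq_assoc (dot_comp_Cm I),
      comp_eq_assoc (B_dot_comp_Cm I), dot_comp_θp]
  rw [h1, comp_assoc, comp_eq_assoc (B_congr hasArity_θp.comp_Cm), B_comp, comp_assoc, arity_B_slide,
    comp_eq_assoc₃ unitCup_comp_Cm_comp_B, comp_assoc, ← comp_dot,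
    comp_eq_assoc theta_inv_comp, I_comp]

/-- Since `unitCup` has no inputs, twist naturality makes it absorb θ₂; one crossing and one twist
of θ₂ are then moved across. -/
theorem unitCup_comp_θm_comp_Cm : unitCup ⊚ (B ⬝ θm) ⊚ Cm = unitCup ⊚ Cp ⊚ (θp : A) := by
  have h1 : unitCup ⊚ (B ⬝ θp) ⊚ (B ⬝ θp) ⊚ Cp ⊚ Cp = (unitCup : A) := by
    have h := theta_naturality (hasArity_unitCup (A := A))
    rw [theta_two_eq, theta, I_comp, comp_eq_assoc unitCup_comp_θp, comp_assoc] at h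
    exact h
  calc unitCup ⊚ (B ⬝ θm) ⊚ (Cm : A)
      = unitCup ⊚ (B ⬝ θp) ⊚ (B ⬝ θp) ⊚ Cp ⊚ Cp ⊚ (B ⬝ θm) ⊚ Cm := by
        nth_rw 1 [← h1]; simp only [comp_assoc]
    _ = unitCup ⊚ (B ⬝ θp) ⊚ ((B ⬝ θp) ⊚ (B ⬝ θm)) ⊚ Cp ⊚ (Cp ⊚ Cm) := by
        rw [comp_eq_assoc hasArity_θm.comp_Cp.symm, comp_assoc,
          comp_eq_assoc hasArity_θm.B_comp_Cp.symm]
        simp only [comp_assoc]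
    _ = unitCup ⊚ Cp ⊚ θp := by
        rw [C_Cm, comp_I, B_congr theta_comp_inv, lam, I_comp, hasArity_θp.B_comp_Cp]

/-- Internal composition `(f, g) ↦ B f g`. -/
def internalComp : A := dot B ⊚ B ⊚ B

theorem hasArity_internalComp : HasArity 2 1 (internalComp : A) := by
  have h := (hasArity_dot (B : A)).add_right 2
  exact h.comp ((hasArity_B.add_right 1).comp hasArity_B)

theorem internalComp_comp_B : internalComp ⊚ B = (B ⬝ B) ⊚ (B : A) := by
  simpa only [internalComp, comp_assoc] using arity_B (A := A)

theorem B_comp_Tr_eq : B ⊚ Tr = (B ⬝ Tr) ⊚ (internalComp : A) := B_comp_Tr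

/-- Write x as (C⁺ I x) I. By `B_comp_Tr_eq`, `Tr` of an application composes the function with the
first output, so only `Tr` of the point `dot I`, that is `unitCup`, remains. -/
theorem Tr_eq_unitCup : Tr = unitCup ⊚ (B ⬝ Cm) ⊚ (flipPos : A) := by
  have hC : dot (Cp : A) ⊚ B ⊚ B ⊚ B = (B ⬝ Cp) ⊚ B ⊚ B := by
    simpa only [HasArity, npow_step, npow_nil, comp_I] using hasArity_Cp (A := A)
  have h0 : dot (Cp ⬝ (I : A)) ⊚ B ⊚ B = Cp ⊚ B := by
    rw [dot_app]; simp only [comp_assoc]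
    rw [hC, comp_eq_assoc (comp_dot Cp I).symm, comp_assoc, comp_eq_assoc dot_I_comp_B, I_comp]
  -- On inputs x, f this is B (C⁺ I x) f = C⁺ f x.
  have hD : (dot (Cp ⬝ (I : A)) ⊚ B) ⊚ internalComp = Cp ⊚ flipPos := by
    refine eq_of_comp_B (n := 2) (((hasArity_dot_comp_B (Cp ⬝ (I : A))).add_right 1).comp
      hasArity_internalComp) (hasArity_Cp.comp hasArity_flipPos) ?_
    rw [comp_assoc, comp_assoc Cp, internalComp_comp_B, flipPos_comp_B,
      comp_eq_assoc ((hasArity_dot_comp_B (Cp ⬝ (I : A))).interchange₁₁ B).symm, comp_assoc,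
      comp_assoc, h0, comp_eq_assoc (bc_pos (A := A))]
    simp only [comp_assoc]
  have h1 : (B ⬝ dot I) ⊚ (dot (Cp ⬝ (I : A)) ⊚ B) ⊚ B = I := by
    rw [comp_assoc, h0, comp_eq_assoc (B_dot_comp_Cp I), dot_I_comp_B]
  calc (Tr : A) = ((B ⬝ dot I) ⊚ (dot (Cp ⬝ (I : A)) ⊚ B) ⊚ B) ⊚ Tr := by rw [h1, I_comp]
    _ = (B ⬝ dot I) ⊚ ((dot (Cp ⬝ (I : A)) ⊚ B) ⊚ (B ⬝ Tr)) ⊚ internalComp := by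
        simp only [comp_assoc]; rw [B_comp_Tr_eq]
    _ = ((B ⬝ unitCup) ⊚ Cp) ⊚ flipPos := by
        rw [← (hasArity_dot_comp_B (Cp ⬝ (I : A))).interchange₁₁, comp_assoc, hD, unitCup, B_comp]
        simp only [comp_assoc]
    _ = _ := by rw [hasArity_unitCup.B_pair_comp_Cp, comp_assoc]

theorem unitCup_comp_Cp_comp_flipPos :
    unitCup ⊚ Cp ⊚ (B ⬝ flipPos) = Tr ⊚ (Cp : A) := by
  rw [Tr_eq_unitCup, comp_assoc, comp_assoc, hasArity_flipPos.op_comp_Cp,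
    comp_eq_assoc (B_congr Cm_C), lam, I_comp]

/-! ### The trace form and its copairing -/

/-- The unit of the self-duality of the object `1`. -/
def cup : A := unitCup ⊚ (B ⬝ θm) ⊚ (B ⬝ Tr) ⊚ Cm ⊚ (B ⬝ flipPos)

/-- The counit of the self-duality of the object `1`. -/
def cap : A := Tr ⬝ (Cp ⊚ (B ⬝ Cp) ⊚ (B ⬝ B) ⊚ B)

theorem hasArity_cup : HasArity 0 2 (cup : A) :=
  hasArity_unitCup.comp (hasArity_θm.B_app.comp (hasArity_Tr.B_app.comp
    ((hasArity_Cm.add_right 1).comp hasArity_flipPos.B_app)))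

theorem hasArity_cap : HasArity 2 0 (cap : A) :=
  HasArity.trace ((hasArity_Cp.add_right 1).comp (hasArity_Cp.B_app.comp
    (hasArity_B.B_app.comp hasArity_B)))

theorem Cm_comp_B_B : (Cm : A) ⊚ (B ⬝ B) = (B ⬝ Cp) ⊚ B ⊚ Cm := by
  rw [hexagon_B_neg, comp_eq_assoc (B_congr C_Cm), lam, I_comp]

theorem Cp_comp_B_B : (Cp : A) ⊚ (B ⬝ B) = (B ⬝ Cm) ⊚ B ⊚ Cp := by
  rw [hexagon_B, comp_eq_assoc (B_congr Cm_C), lam, I_comp]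

/-- Applying the second leg of Σ |i⟩⟨j| ⊗ |j⟩⟨i| to x leaves Σ |x⟩⟨j| ⊗ |j⟩; the twist built into
`cup` cancels the one produced by yanking. -/
theorem cup_comp_B_B : cup ⊚ (B ⬝ B) = (Tr : A) := by
  calc cup ⊚ (B ⬝ (B : A))
      = unitCup ⊚ (B ⬝ θm) ⊚ (B ⬝ Tr) ⊚ (Cm ⊚ (B ⬝ (B ⬝ Cp))) ⊚ (B ⬝ B) ⊚ (B ⬝ B) := by
        simp only [cup, comp_assoc]; rw [B_congr flipPos_comp_B]; simp only [B_comp]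
    _ = unitCup ⊚ (B ⬝ θm) ⊚ (B ⬝ (Tr ⊚ (B ⬝ Cp) ⊚ Cp)) ⊚ B ⊚ Cm ⊚ (B ⬝ B) := by
        rw [← hasArity_Cm.interchange₂₂]; simp only [comp_assoc]
        rw [comp_eq_assoc Cm_comp_B_B]; simp only [B_comp, comp_assoc]
    _ = unitCup ⊚ (B ⬝ (θm ⊚ Cp)) ⊚ ((B ⬝ (B ⬝ Tr)) ⊚ B) ⊚ Cm ⊚ (B ⬝ B) := by
        rw [hasArity_Tr.dup_comp_Cp]; simp only [B_comp, comp_assoc]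
    _ = unitCup ⊚ (B ⬝ Cp) ⊚ ((B ⬝ (B ⬝ θm)) ⊚ B) ⊚ (B ⬝ Tr) ⊚ Cm ⊚ (B ⬝ B) := by
        rw [hasArity_θm.comp_Cp, arity_B_slide]; simp only [B_comp, comp_assoc]
    _ = (unitCup ⊚ (B ⬝ Cp) ⊚ B) ⊚ (B ⬝ (θm ⊚ Tr)) ⊚ Cm ⊚ (B ⬝ B) := by
        rw [arity_B_slide]; simp only [B_comp, comp_assoc]
    _ = θp ⊚ (θm ⊚ Tr) ⊚ dot I ⊚ Cm ⊚ (B ⬝ B) := by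
        rw [unitCup_comp_Cp_comp_B, comp_assoc, comp_eq_assoc (comp_dot (θm ⊚ Tr) I).symm,
          comp_assoc]
    _ = Tr := by
        rw [comp_eq_assoc (dot_comp_Cm I), B_congr dot_I_comp_B, lam, comp_I,
          comp_eq_assoc theta_comp_inv, I_comp]

/-- Applying the first leg to x instead gives Σ |i⟩ ⊗ |x⟩⟨i|, the two outputs of `Tr` exchanged, at
the price of framing corrections. -/
theorem cup_comp_Cm_comp_B : cup ⊚ (B ⬝ Cm) ⊚ B = θm ⊚ Tr ⊚ Cp ⊚ (θp : A) := by
  have hp := (hasArity_unitCup.interchange₀₂ (θm : A)).symm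
  calc cup ⊚ (B ⬝ Cm) ⊚ (B : A)
      = unitCup ⊚ (B ⬝ θm) ⊚ (B ⬝ Tr) ⊚ Cm ⊚ (B ⬝ (flipPos ⊚ Cm)) ⊚ B := by
        simp only [cup, B_comp, comp_assoc]
    _ = unitCup ⊚ (B ⬝ θm) ⊚ (B ⬝ Tr) ⊚ (Cm ⊚ (B ⬝ (B ⬝ Cm))) ⊚ (B ⬝ Cm) ⊚
          ((B ⬝ (B ⬝ flipPos)) ⊚ B) := by
        rw [hasArity_flipPos.op_comp_Cm]; simp only [B_comp, comp_assoc]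
    _ = unitCup ⊚ (B ⬝ θm) ⊚ (B ⬝ Tr) ⊚ (B ⬝ (B ⬝ Cm)) ⊚ (Cm ⊚ (B ⬝ Cm) ⊚ B) ⊚
          (B ⬝ flipPos) := by
        rw [← hasArity_Cm.interchange₂₂, arity_B_slide]; simp only [comp_assoc]
    _ = unitCup ⊚ (B ⬝ θm) ⊚ (B ⬝ (Tr ⊚ (B ⬝ Cm) ⊚ B)) ⊚ Cm ⊚ (B ⬝ flipPos) := by
        rw [← bc_neg]; simp only [B_comp, comp_assoc]
    _ = unitCup ⊚ (B ⬝ (B ⬝ θm)) ⊚ (B ⬝ θm) ⊚ Cm ⊚ (B ⬝ flipPos) := by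
        rw [Tr_comp_Cm_comp_B, comp_eq_assoc (B_congr (hasArity_θm.interchange₁₁ θm).symm), B_comp,
          comp_assoc]
    _ = θm ⊚ (unitCup ⊚ (B ⬝ θm) ⊚ Cm) ⊚ (B ⬝ flipPos) := by
        rw [comp_eq_assoc hp]; simp only [comp_assoc]
    _ = θm ⊚ (unitCup ⊚ Cp ⊚ (B ⬝ flipPos)) ⊚ θp := by
        rw [unitCup_comp_θm_comp_Cm]; simp only [comp_assoc]
        rw [← hasArity_θp.interchange₁₁ flipPos]
    _ = _ := by rw [unitCup_comp_Cp_comp_flipPos, comp_assoc]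

theorem Tr_comp_Cp_comp_B_B : Tr ⊚ Cp ⊚ (B ⬝ B) = (B ⬝ θm) ⊚ (Cp : A) := by
  rw [Cp_comp_B_B, ← Tr_comp_Cm_comp_B]; simp only [comp_assoc]

theorem Tr_comp_Cm_comp_B_B : Tr ⊚ Cm ⊚ (B ⬝ B) = (B ⬝ θp) ⊚ (Cm : A) := by
  rw [Cm_comp_B_B, ← Tr_comp_Cp_comp_B]; simp only [comp_assoc]

theorem Tr_app_Tr_comp_Cm : Tr ⬝ (Tr ⊚ Cm) = dot (I : A) := by
  refine eq_of_comp_B (n := 0) (hasArity_Tr.comp hasArity_Cm).trace (hasArity_dot I) ?_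
  rw [← Tr_comp_right, comp_assoc, Tr_comp_Cm_comp_B_B, Tr_comp_left, yanking_neg, theta_comp_inv,
    dot_I_comp_B]

theorem dot_I_comp_internalComp : (B ⬝ dot I) ⊚ internalComp = (I : A) := by
  refine eq_of_comp_B (n := 1) ((hasArity_dot (I : A)).B_app.comp hasArity_internalComp)
    (hasArity_I 1) ?_
  rw [comp_assoc, internalComp_comp_B, comp_eq_assoc (B_congr dot_I_comp_B), lam]

theorem braid_pos_neg_neg : (B ⬝ (Cp : A)) ⊚ Cm ⊚ (B ⬝ Cm) = Cm ⊚ (B ⬝ Cm) ⊚ Cp := by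
  calc (B ⬝ (Cp : A)) ⊚ Cm ⊚ (B ⬝ Cm)
      = (B ⬝ Cp) ⊚ (Cm ⊚ (B ⬝ Cm) ⊚ Cm) ⊚ Cp := by
        simp only [comp_assoc]; rw [Cm_C, comp_I]
    _ = _ := by
        rw [← cox₃_neg]; simp only [comp_assoc]; rw [comp_eq_assoc (B_congr C_Cm), lam, I_comp]

/-- The first zigzag identity. -/
theorem cup_comp_B_cap : cup ⊚ (B ⬝ cap) = (I : A) := by
  -- The strand to the left of the cap is passed to its right, so that the prefix can be drawn
  -- inside the trace defining `cap` by `Tr_comp_left`.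
  have hcap : B ⬝ (cap : A) = Cm ⊚ (B ⬝ Cm) ⊚ cap := by
    have h := sigmaOneInv_naturality (hasArity_cap (A := A))
    rwa [sigmaOneInv_two, sigmaOneInv, comp_I, comp_assoc] at h
  have hin := fun x : A => hasArity_cup.interchange₀₂ x
  have hW : (B ⬝ cup) ⊚ (B ⬝ Cm) ⊚ (B ⬝ (B ⬝ Cm)) ⊚ Cp ⊚ (B ⬝ Cp) ⊚ (B ⬝ B) ⊚ (B : A) =
      Cp ⊚ B ⊚ Tr ⊚ Cm := by
    calc _ = cup ⊚ ((B ⬝ Cm) ⊚ Cm ⊚ (B ⬝ Cm)) ⊚ ((B ⬝ (B ⬝ Cm)) ⊚ Cp) ⊚ (B ⬝ Cp) ⊚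
          (B ⬝ B) ⊚ (B : A) := by
          rw [← hasArity_cup.pair_comp_Cm]; simp only [comp_assoc]
      _ = cup ⊚ Cm ⊚ (B ⬝ (Cm ⊚ (B ⬝ Cm) ⊚ Cp)) ⊚ (B ⬝ B) ⊚ (B : A) := by
          rw [cox₃_neg, hasArity_Cp.interchange₂₂]; simp only [B_comp, comp_assoc]
          rw [comp_eq_assoc Cm_C, I_comp]
      _ = cup ⊚ (Cm ⊚ (B ⬝ (B ⬝ Cp))) ⊚ (B ⬝ Cm) ⊚ (B ⬝ (B ⬝ Cm)) ⊚ (B ⬝ B) ⊚ (B : A) := by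
          rw [← braid_pos_neg_neg]; simp only [B_comp, comp_assoc]
      _ = Cp ⊚ cup ⊚ Cm ⊚ (B ⬝ (Cm ⊚ (B ⬝ Cm) ⊚ B)) ⊚ (B : A) := by
          rw [← hasArity_Cm.interchange₂₂, comp_assoc, comp_eq_assoc (hin Cp).symm]
          simp only [B_comp, comp_assoc]
      _ = Cp ⊚ cup ⊚ (Cm ⊚ (B ⬝ (B ⬝ B))) ⊚ (B ⬝ Cm) ⊚ (B : A) := by
          rw [← bc_neg]; simp only [B_comp, comp_assoc]
      _ = Cp ⊚ B ⊚ cup ⊚ Cm ⊚ (B ⬝ Cm) ⊚ (B : A) := by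
          rw [← hasArity_Cm.interchange₂₂, comp_assoc, comp_eq_assoc (hin B).symm, comp_assoc]
      _ = Cp ⊚ B ⊚ Tr ⊚ Cm := by rw [← bc_neg, ← cup_comp_B_B, comp_assoc]
  -- This puts internal composition outside the trace; what is left inside traces to the point `I`,
  -- so the zigzag becomes the unit law for composition.
  have hV : Cp ⊚ B ⊚ Tr ⊚ (Cm : A) = (Tr ⊚ Cm) ⊚ (B ⬝ (Cp ⊚ internalComp)) := by
    calc Cp ⊚ B ⊚ Tr ⊚ (Cm : A) = (Cp ⊚ (B ⬝ Tr)) ⊚ (internalComp ⊚ Cm) := by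
          rw [comp_eq_assoc B_comp_Tr_eq]; simp only [comp_assoc]
      _ = Tr ⊚ (B ⬝ Cp) ⊚ (Cp ⊚ (B ⬝ Cm) ⊚ Cm) ⊚ (B ⬝ internalComp) := by
          rw [← hasArity_Tr.dup_comp_Cp, hasArity_internalComp.op_comp_Cm]; simp only [comp_assoc]
      _ = _ := by
          rw [← braid_neg_neg_pos]; simp only [comp_assoc]
          rw [comp_eq_assoc (B_congr C_Cm), lam, I_comp, B_comp]
  rw [hcap, cap, ← comp_assoc, ← comp_assoc, ← Tr_comp_left, B_comp, B_comp]
  simp only [comp_assoc]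
  rw [hW, hV, Tr_comp_right, Tr_app_Tr_comp_Cm, ← comp_assoc, dot_comp_Cp,
    dot_I_comp_internalComp]

/-- The second zigzag identity. -/
theorem B_cup_comp_cap : (B ⬝ cup) ⊚ cap = (I : A) := by
  refine eq_of_comp_B (n := 1) (hasArity_cup.B_app.comp (hasArity_cap.add_right 1))
    (hasArity_I 1) ?_
  have h1 : (B ⬝ (B ⬝ cup)) ⊚ Cp ⊚ (B ⬝ Cp) ⊚ (B ⬝ B) ⊚ B =
      Cp ⊚ (B ⬝ (θm ⊚ Tr ⊚ Cp ⊚ θp)) ⊚ (B : A) := by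
    rw [comp_eq_assoc (hasArity_Cp.interchange₂₂ cup), comp_assoc,
      comp_eq_assoc (B_congr hasArity_cup.B_pair_comp_Cp), ← cup_comp_Cm_comp_B]
    simp only [B_comp, comp_assoc]
  -- After one more application the traced body is a single crossing between maps that tightening
  -- pulls out, so yanking finishes.
  have h2 : (Cp ⊚ (B ⬝ (θm ⊚ Tr ⊚ Cp ⊚ θp)) ⊚ (B : A)) ⊚ (B ⬝ B) = (B ⬝ B) ⊚ Cp ⊚ (B ⬝ θm) := by
    calc _ = Cp ⊚ (B ⬝ (θm ⊚ Tr ⊚ Cp ⊚ (θp ⊚ (B ⬝ B)))) ⊚ (B : A) := by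
          simp only [comp_assoc]; rw [← arity_B_slide]; simp only [B_comp, comp_assoc]
      _ = Cp ⊚ (B ⬝ (θm ⊚ (Tr ⊚ Cp ⊚ (B ⬝ B)) ⊚ θp)) ⊚ (B : A) := by
          rw [← hasArity_θp.interchange₁₁]; simp only [comp_assoc]
      _ = Cp ⊚ (B ⬝ (θm ⊚ (B ⬝ (θm ⊚ θp)) ⊚ Cp)) ⊚ (B : A) := by
          rw [Tr_comp_Cp_comp_B_B, comp_assoc, ← hasArity_θp.B_comp_Cp]
          simp only [B_comp, comp_assoc]
      _ = θm ⊚ (Cp ⊚ (B ⬝ Cp) ⊚ B) := by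
          rw [theta_inv_comp, lam, I_comp, B_comp, comp_eq_assoc hasArity_θm.comp_Cp]
          simp only [comp_assoc]
      _ = _ := by
          rw [← bc_pos, comp_eq_assoc (hasArity_θm.interchange₁₁ B).symm, comp_assoc,
            hasArity_θm.comp_Cp]
  rw [cap, ← Tr_comp_left, ← Tr_comp_right, h1, h2, Tr_comp_left, Tr_comp_right, yanking_pos,
    theta_comp_inv, comp_I, I_comp]

theorem Cp_comp_monodromy_neg :
    (Cp : A) ⊚ (B ⬝ Cm) ⊚ (B ⬝ Cm) = (B ⬝ Cm) ⊚ Cm ⊚ Cm ⊚ (B ⬝ Cp) ⊚ Cp := by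
  have h : (Cp : A) ⊚ (B ⬝ Cm) = (B ⬝ Cm) ⊚ Cm ⊚ (B ⬝ Cp) ⊚ Cp := by
    have e := congrArg (fun z : A => z ⊚ Cp) (braid_neg_neg_pos (A := A))
    simp only [comp_assoc] at e
    rw [e, Cm_C, comp_I]
  rw [comp_eq_assoc h]
  simp only [comp_assoc]
  rw [← braid_neg_pos_pos]

/-- Since `cup ⊚ (B ⬝ B) = Tr`, this says the twist slides between the legs of `cup` once the second
leg has been applied. `pair_ext` reduces it to the value computed in `Tr_comp_θp`. -/
theorem Tr_comp_θp_eq : Tr ⊚ θp = cup ⊚ (B ⬝ (θp ⊚ (B : A))) := by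
  refine pair_ext (hasArity_Tr.comp (hasArity_θp.add_right 1))
    ((hasArity_cup.add_right 1).comp ((hasArity_θp.add_right 1).comp hasArity_B).B_app) ?_
  have hin := fun x : A => hasArity_cup.interchange₀₂ x
  have hY : (Tr : A) ⊚ Cp ⊚ (B ⬝ Cm) ⊚ (B ⬝ Cm) ⊚ (B ⬝ B) = Cm ⊚ Cm ⊚ (B ⬝ θp) ⊚ Cp := by
    calc _ = Tr ⊚ (Cp ⊚ (B ⬝ Cm) ⊚ (B ⬝ Cm)) ⊚ (B ⬝ (B : A)) := by simp only [comp_assoc]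
      _ = (Tr ⊚ (B ⬝ Cm) ⊚ Cm) ⊚ Cm ⊚ ((B ⬝ Cp) ⊚ Cp ⊚ (B ⬝ B)) := by
          rw [Cp_comp_monodromy_neg]; simp only [comp_assoc]
      _ = Cm ⊚ ((B ⬝ Tr) ⊚ Cm) ⊚ B ⊚ Cp := by
          rw [hasArity_Tr.dup_comp_Cm, ← hexagon_B]; simp only [comp_assoc]
      _ = Cm ⊚ Cm ⊚ (Tr ⊚ (B ⬝ Cp) ⊚ B) ⊚ Cp := by
          rw [B_Tr_comp_Cm]; simp only [comp_assoc]
      _ = _ := by rw [Tr_comp_Cp_comp_B]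
  have hB4 : (Cm : A) ⊚ Cm ⊚ (B ⬝ Cm) ⊚ Cm = (B ⬝ Cm) ⊚ Cm ⊚ (B ⬝ Cm) ⊚ (B ⬝ Cm) := by
    rw [← cox₃_neg, comp_eq_assoc₃ (cox₃_neg (A := A)).symm]; simp only [comp_assoc]
  rw [comp_assoc, Tr_comp_θp]
  symm
  calc (cup ⊚ (B ⬝ (θp ⊚ B))) ⊚ (B ⬝ Cm) ⊚ (B : A)
      = (cup ⊚ (B ⬝ (B ⬝ θm))) ⊚ (B ⬝ (Cm ⊚ Cm ⊚ B ⊚ (θp ⊚ Cm))) ⊚ B := by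
        rw [θp_comp_B]; simp only [B_comp, comp_assoc]
    _ = θm ⊚ cup ⊚ (B ⬝ (Cm ⊚ Cm ⊚ (B ⊚ Cm))) ⊚ ((B ⬝ (B ⬝ θp)) ⊚ B) := by
        rw [← hin, hasArity_θp.comp_Cm]; simp only [B_comp, comp_assoc]
    _ = θm ⊚ cup ⊚ (B ⬝ (Cm ⊚ Cm ⊚ (B ⬝ Cm) ⊚ Cm)) ⊚ ((B ⬝ (B ⬝ B)) ⊚ B) ⊚ (B ⬝ θp) := by
        rw [hexagon_B_neg, arity_B_slide]; simp only [B_comp, comp_assoc]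
    _ = θm ⊚ (cup ⊚ (B ⬝ (B ⬝ Cm))) ⊚ (B ⬝ Cm) ⊚ (B ⬝ (B ⬝ (Cm ⊚ Cm))) ⊚ B ⊚ (B ⬝ B) ⊚
          (B ⬝ θp) := by
        rw [hB4, arity_B_slide]; simp only [B_comp, comp_assoc]
    _ = θm ⊚ Cm ⊚ (cup ⊚ (B ⬝ Cm) ⊚ B) ⊚ (B ⬝ (Cm ⊚ Cm)) ⊚ (B ⬝ B) ⊚ (B ⬝ θp) := by
        rw [← hin, comp_eq_assoc (arity_B_slide (Cm ⊚ Cm))]; simp only [comp_assoc]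
    _ = θm ⊚ Cm ⊚ θm ⊚ Tr ⊚ Cp ⊚ (θp ⊚ (B ⬝ (Cm ⊚ Cm ⊚ B ⊚ θp))) := by
        rw [cup_comp_Cm_comp_B]; simp only [B_comp, comp_assoc]
    _ = θm ⊚ Cm ⊚ θm ⊚ (Tr ⊚ Cp ⊚ (B ⬝ Cm) ⊚ (B ⬝ Cm) ⊚ (B ⬝ B)) ⊚ (B ⬝ θp) ⊚ θp := by
        rw [← hasArity_θp.interchange₁₁]; simp only [B_comp, comp_assoc]
    _ = θm ⊚ (Cm ⊚ θm) ⊚ Cm ⊚ (Cm ⊚ (B ⬝ θp)) ⊚ (Cp ⊚ (B ⬝ θp)) ⊚ θp := by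
        rw [hY]; simp only [comp_assoc]
    _ = Cm ⊚ Cm ⊚ θp := by
        have e1 := (hasArity_θm (A := A)).B_comp_Cm.symm
        have e2 := (hasArity_θp (A := A)).B_comp_Cm.symm
        have e3 := (hasArity_θp (A := A)).comp_Cm.symm
        have e4 := (hasArity_θp (A := A)).B_comp_Cp.symm
        have e5 := (hasArity_θp (A := A)).comp_Cp.symm
        have e6 := (hasArity_θp (A := A)).interchange₁₁ θm
        have e7 := theta_inv_comp (A := A)
        have e8 := B_congr e7
        have e9 := Cm_C (A := A)
        simp only [comp_assoc, e1, e2, e3, e4, e5, e9, comp_eq_assoc e2,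
          comp_eq_assoc e3, comp_eq_assoc e6, comp_eq_assoc e7, comp_eq_assoc e8, lam, I_comp, comp_I]

theorem cup_comp_θp : cup ⊚ θp = cup ⊚ (B ⬝ (θp : A)) := by
  have hin := fun x : A => hasArity_cup.interchange₀₂ x
  -- t is the mate of `θp` under the self-duality. It is shown to agree with `θp` after application,
  -- hence to equal it.
  obtain ⟨t, ht_def⟩ : ∃ t : A, t = (B ⬝ (cup ⊚ θp)) ⊚ cap := ⟨_, rfl⟩
  have ht : HasArity 1 1 t := ht_def ▸
    (hasArity_cup.comp (hasArity_θp.add_right 1)).B_app.comp (hasArity_cap.add_right 1)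
  have h1 : cup ⊚ θp = cup ⊚ (B ⬝ t) := by
    rw [ht_def, B_comp, comp_eq_assoc (hin (cup ⊚ θp)).symm, comp_assoc, cup_comp_B_cap, comp_I]
  have h2 : t ⊚ B = θp ⊚ B := by
    have key : cup ⊚ (B ⬝ (t ⊚ B)) = cup ⊚ (B ⬝ (θp ⊚ (B : A))) := by
      rw [← Tr_comp_θp_eq, ← cup_comp_B_B, comp_assoc, hasArity_θp.interchange₁₁, ← comp_assoc, h1,
        B_comp, comp_assoc]
    have cancel : ∀ x : A, (B ⬝ (cup ⊚ (B ⬝ x))) ⊚ cap = x := fun x => by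
      rw [B_comp, comp_assoc, hasArity_cap.interchange₂₀, comp_eq_assoc B_cup_comp_cap, I_comp]
    rw [← cancel (t ⊚ B), key, cancel]
  rw [h1, eq_of_comp_B (n := 1) ht hasArity_θp h2]

/-! ### Self-duality of all objects -/

/-- The unit of the self-duality of the object `m`. -/
def cupPow : ℕ → A
  | 0 => I
  | m + 1 => cup ⊚ (B ⬝ cupPow m)

/-- The counit of the self-duality of the object `m`. -/
def capPow : ℕ → A
  | 0 => I
  | m + 1 => (npow B m ⬝ cap) ⊚ capPow m

theorem hasArity_cupPow (m : ℕ) : HasArity 0 (m + m) (cupPow m : A) := by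
  induction m with
  | zero => exact hasArity_I 0
  | succ m ih =>
    have h := (ih.B_app).add_right 1
    rw [show m + m + 1 + 1 = m + 1 + (m + 1) by omega] at h
    exact hasArity_cup.comp h

theorem hasArity_capPow (m : ℕ) : HasArity (m + m) 0 (capPow m : A) := by
  induction m with
  | zero => exact hasArity_I 0
  | succ m ih =>
    have h := ((hasArity_cap (A := A)).add_left m).add_right m
    rw [show m + 2 + m = m + 1 + (m + 1) by omega] at h
    exact h.comp ih

theorem _root_.RibbonSignature.HasArity.interchange_zero {n : ℕ} {a : A} (h : HasArity 0 n a)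
    (x : A) : a ⊚ (npow B n ⬝ x) = x ⊚ a := by
  rw [← h.interchange x, npow_nil, I_app]

theorem cupPow_comp_capPow (m : ℕ) : cupPow m ⊚ (npow B m ⬝ capPow m) = (I : A) := by
  induction m with
  | zero => rw [npow_nil, I_app, cupPow, capPow, I_comp]
  | succ m ih =>
    have h := (hasArity_cupPow (A := A) m).interchange_zero cap
    rw [npow_B_add] at h
    rw [cupPow, capPow, npow_B_succ, npow_B_comp, comp_assoc, ← B_comp, comp_eq_assoc h, comp_assoc,
      ih, comp_I, cup_comp_B_cap]

theorem npow_B_cupPow_comp_capPow (m : ℕ) : (npow B m ⬝ cupPow m) ⊚ capPow m = (I : A) := by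
  induction m with
  | zero => rw [npow_nil, I_app, cupPow, capPow, I_comp]
  | succ m ih =>
    rw [cupPow, capPow, npow_step', comp_app, ← comp_assoc, ← npow_B_comp, B_comp, comp_assoc,
      hasArity_cap.interchange₂₀, comp_eq_assoc B_cup_comp_cap, I_comp, ih]

/-- Exchanging two nested cups by the braiding. -/
theorem nested_cup_comp_sigma {k m : ℕ} {a b : A} (ha : HasArity 0 (k + k) a)
    (hb : HasArity 0 (m + m) b) :
    a ⊚ (npow B k ⬝ b) ⊚ sigma k m = b ⊚ (npow B m ⬝ a) ⊚ (npow B (m + k) ⬝ sigma k m) := by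
  -- Strands may be pulled across the whole cup b, so crossing its first m legs amounts to
  -- uncrossing the last m; `h2` is the analogue for a.
  have h1 : (npow B k ⬝ b) ⊚ sigma k m = b ⊚ (npow B m ⬝ sigmaInv k m) := by
    have h := sigma_naturality_right hb k
    rw [sigma_add_right, sigma_zero_right, I_comp] at h
    have h' := congrArg (fun z : A => z ⊚ (npow B m ⬝ sigmaInv k m)) h
    simp only [comp_assoc] at h'
    rwa [← npow_B_comp, sigma_comp_inv, npow_B_I, comp_I] at h'
  have h2 : (npow B m ⬝ a) ⊚ sigmaInv k m = a ⊚ (npow B k ⬝ sigma k m) := by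
    have h := sigma_naturality_left ha m
    rw [sigma_add_left, sigma_zero_left, I_comp] at h
    have h' := congrArg (fun z : A => z ⊚ sigmaInv k m) h
    simp only [comp_assoc] at h'
    rw [sigma_comp_inv, comp_I] at h'
    exact h'.symm
  rw [h1, ← comp_assoc, ← hb.interchange_zero a, comp_assoc, npow_B_add m m, ← npow_B_comp, h2,
    npow_B_comp, npow_B_add m k]

/-- Sliding a word across nested cups reverses its factors and exchanges σ_{1,m} with σ_{m,1}
according to `nested_cup_comp_sigma`. The resulting word again represents θ_{m+1}. -/
theorem cupPow_comp_theta (m : ℕ) :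
    cupPow m ⊚ theta m = cupPow m ⊚ (npow B m ⬝ (theta m : A)) := by
  induction m with
  | zero => rw [npow_nil, I_app]
  | succ m ih =>
    have hc := hasArity_cupPow (A := A) m
    have e1 := nested_cup_comp_sigma (k := 1) hasArity_cup hc
    have e2 := nested_cup_comp_sigma (m := 1) hc (hasArity_cup (A := A))
    rw [npow_B_one_app] at e1 e2
    -- The word in which the factors of the definition of θ_{m+1} arrive on the other legs.
    have hθ : theta (m + 1) = sigma m 1 ⊚ (B ⬝ theta m) ⊚ sigma 1 m ⊚ (npow B m ⬝ (θp : A)) := by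
      rw [theta_add, theta_one, sigma_naturality_left hasArity_θp m, ← npow_B_one_app, comp_eq_assoc (sigma_naturality_left (hasArity_theta (A := A) m) 1).symm,
        comp_assoc]
    have s1 : cup ⊚ (B ⬝ cupPow m) ⊚ θp =
        cup ⊚ (B ⬝ cupPow m) ⊚ (npow B (m + 1) ⬝ (npow B m ⬝ (θp : A))) := by
      have h := hc.interchange_zero (θp : A)
      rw [hasArity_θp.interchange₁₁, comp_eq_assoc cup_comp_θp, comp_assoc, ← B_comp, ← h, B_comp,
        ← npow_B_succ, Nat.add_right_comm, npow_B_add]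
    have i1 := (hasArity_sigma (A := A) 1 m).interchange (npow B m ⬝ θp)
    rw [Nat.add_comm 1 m] at i1
    have i2 := ((hasArity_theta (A := A) m).add_right 1).interchange (npow B m ⬝ θp)
    have i3 := (hasArity_sigma (A := A) m 1).interchange (npow B m ⬝ θp)
    rw [Nat.add_comm 1 m] at i3
    have j1 := ((hasArity_theta (A := A) m).add_right 1).interchange (sigma 1 m)
    have j2 := (hasArity_sigma (A := A) m 1).interchange (sigma 1 m)
    rw [Nat.add_comm 1 m] at j2
    have j3 := (hasArity_theta (A := A) m).interchange cup
    have j4 := (hasArity_sigma (A := A) m 1).interchange (B ⬝ theta m)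
    rw [Nat.add_comm 1 m] at j4
    have j5 := hasArity_cup.interchange_zero (theta m : A)
    rw [npow_B_two_app] at j5
    have j6 : cupPow m ⊚ (npow B m ⬝ cup) ⊚ theta m =
        cupPow m ⊚ (npow B m ⬝ cup) ⊚ (npow B (m + 1) ⬝ (B ⬝ (theta m : A))) := by
      rw [j3, comp_eq_assoc ih, comp_assoc, ← npow_B_comp, ← j5, npow_B_comp, npow_B_add m 1,
        npow_B_one_app]
    calc cupPow (m + 1) ⊚ theta (m + 1)
        = (cup ⊚ (B ⬝ cupPow m) ⊚ θp) ⊚ sigma 1 m ⊚ theta m ⊚ sigma m 1 := by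
          simp only [cupPow, theta, comp_assoc]
      _ = (cup ⊚ (B ⬝ cupPow m) ⊚ sigma 1 m) ⊚ theta m ⊚ sigma m 1 ⊚
            (npow B (m + 1) ⬝ (npow B m ⬝ (θp : A))) := by
          rw [s1]; simp only [comp_assoc]
          rw [comp_eq_assoc i1, comp_assoc, comp_eq_assoc i2, comp_assoc, i3]
      _ = (cupPow m ⊚ (npow B m ⬝ cup) ⊚ theta m) ⊚ sigma m 1 ⊚ (npow B (m + 1) ⬝ sigma 1 m) ⊚
            (npow B (m + 1) ⬝ (npow B m ⬝ (θp : A))) := by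
          rw [e1]; simp only [comp_assoc]
          rw [comp_eq_assoc j1, comp_assoc, comp_eq_assoc j2, comp_assoc]
      _ = (cupPow m ⊚ (npow B m ⬝ cup) ⊚ sigma m 1) ⊚ (npow B (m + 1) ⬝ (B ⬝ theta m)) ⊚
            (npow B (m + 1) ⬝ sigma 1 m) ⊚ (npow B (m + 1) ⬝ (npow B m ⬝ (θp : A))) := by
          rw [j6]; simp only [comp_assoc]
          rw [comp_eq_assoc j4, comp_assoc]
      _ = _ := by
          rw [e2, hθ, cupPow, Nat.add_comm 1 m]; simp only [npow_B_comp, comp_assoc]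

theorem cupPow_one : cupPow 1 = (cup : A) := by rw [cupPow, cupPow, lam, comp_I]

theorem capPow_one : capPow 1 = (cap : A) := by rw [capPow, capPow, npow_nil, I_app, comp_I]

/-- The trace combinator in terms of the self-duality. -/
theorem B_cup_comp_eq_Tr {φ : A} (hφ : HasArity 2 1 φ) (h : φ ⊚ B = B ⬝ cap) :
    (B ⬝ cup) ⊚ (B ⬝ (B ⬝ θp)) ⊚ (B ⬝ Cp) ⊚ φ = Tr := by
  refine pair_ext ((hasArity_cup.B_app).comp ((hasArity_θp.B_app.B_app).comp
    (hasArity_Cp.B_app.comp (hφ.add_right 1)))) hasArity_Tr ?_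
  have h1 : cup ⊚ (B ⬝ θp) ⊚ (B ⬝ θp) ⊚ Cp ⊚ Cp = (cup : A) := by
    have h := theta_naturality (hasArity_cup (A := A))
    rw [theta_two_eq, theta, I_comp, comp_eq_assoc cup_comp_θp, comp_assoc] at h
    exact h
  have hcap : B ⬝ (cap : A) = Cm ⊚ (B ⬝ Cm) ⊚ cap := by
    have h := sigmaOneInv_naturality (hasArity_cap (A := A))
    rwa [sigmaOneInv_two, sigmaOneInv, comp_I, comp_assoc] at h
  have h2 : (B ⬝ Cm) ⊚ cap = Cp ⊚ (B ⬝ (cap : A)) := by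
    rw [hcap, ← comp_assoc Cp, C_Cm, I_comp]
  -- `cup` absorbs θ₂ (`h1`); removing one of the two twists in it leaves an inverse twist.
  have h3 : cup ⊚ (B ⬝ θp) ⊚ Cp ⊚ Cp = cup ⊚ (θm : A) := by
    have e : cup ⊚ (θm : A) = cup ⊚ (B ⬝ θm) := by
      calc cup ⊚ (θm : A) = cup ⊚ θm ⊚ (B ⬝ θp) ⊚ (B ⬝ θm) := by
            rw [B_congr theta_comp_inv, lam, comp_I]
        _ = (cup ⊚ θp) ⊚ θm ⊚ (B ⬝ θm) := by
            rw [cup_comp_θp, comp_assoc, comp_eq_assoc (hasArity_θm.interchange₁₁ θp), comp_assoc]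
        _ = _ := by rw [comp_assoc, comp_eq_assoc theta_comp_inv, I_comp]
    calc cup ⊚ (B ⬝ θp) ⊚ Cp ⊚ (Cp : A)
        = cup ⊚ (B ⬝ θm) ⊚ (B ⬝ θp) ⊚ (B ⬝ θp) ⊚ Cp ⊚ Cp := by
          rw [comp_eq_assoc (B_congr theta_inv_comp), lam, I_comp]
      _ = (cup ⊚ θm) ⊚ (B ⬝ θp) ⊚ (B ⬝ θp) ⊚ Cp ⊚ Cp := by rw [e, comp_assoc]
      _ = (cup ⊚ (B ⬝ θp) ⊚ (B ⬝ θp) ⊚ Cp ⊚ Cp) ⊚ θm := by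
          have c1 := (hasArity_θm (A := A)).comp_Cp
          have c2 := (hasArity_θm (A := A)).B_comp_Cp
          simp only [comp_assoc]
          rw [← c2, comp_eq_assoc c1.symm, comp_assoc,
            comp_eq_assoc (hasArity_θm.interchange₁₁ θp),
            comp_assoc, comp_eq_assoc (hasArity_θm.interchange₁₁ θp), comp_assoc]
      _ = _ := by rw [h1]
  calc ((B ⬝ cup) ⊚ (B ⬝ (B ⬝ θp)) ⊚ (B ⬝ Cp) ⊚ φ) ⊚ (B ⬝ Cm) ⊚ B
      = (B ⬝ cup) ⊚ (B ⬝ (B ⬝ θp)) ⊚ (B ⬝ Cp) ⊚ (B ⬝ (B ⬝ Cm)) ⊚ φ ⊚ B := by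
        simp only [comp_assoc]; rw [comp_eq_assoc (hφ.interchange₂₁ Cm).symm, comp_assoc]
    _ = B ⬝ (cup ⊚ (B ⬝ θp) ⊚ Cp ⊚ (B ⬝ Cm) ⊚ cap) := by
        rw [h]; simp only [B_comp]
    _ = B ⬝ ((cup ⊚ (B ⬝ θp) ⊚ Cp ⊚ Cp) ⊚ (B ⬝ cap)) := by
        rw [h2]; simp only [comp_assoc]
    _ = B ⬝ θm := by
        rw [h3, comp_assoc, ← hasArity_θm.interchange₁₁, comp_eq_assoc cup_comp_B_cap, I_comp]
    _ = _ := Tr_comp_Cm_comp_B.symm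

end RibbonCombinatoryAlgebra

/-! ### The ribbon structure on the internal PROB -/

namespace InternalPROB

open RibbonSignature RibbonCombinatoryAlgebra

variable {A : Type u} [RibbonCombinatoryAlgebra A]

scoped instance braided : BraidedCategory (InternalPROB A) where
  braiding X Y :=
    { hom := ⟨sigma X.deg Y.deg, hasArity_sigma X.deg Y.deg⟩
      inv := ⟨sigmaInv X.deg Y.deg, hasArity_sigmaInv X.deg Y.deg⟩
      hom_inv_id := hom_ext (sigma_comp_inv X.deg Y.deg)
      inv_hom_id := hom_ext (sigmaInv_comp X.deg Y.deg) }
  braiding_naturality_right X _ _ f := hom_ext (sigma_naturality_right f.arity X.deg)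
  braiding_naturality_left f Z := hom_ext (sigma_naturality_left f.arity Z.deg)
  hexagon_forward X Y Z := by ext; simp [I_comp, comp_I, sigma_add_right]
  hexagon_reverse X Y Z := by ext; simp [I_comp, comp_I, sigma_add_left]

scoped instance balanced : BalancedCategory (InternalPROB A) where
  twist X :=
    { hom := ⟨theta X.deg, hasArity_theta X.deg⟩
      inv := ⟨thetaInv X.deg, hasArity_thetaInv X.deg⟩
      hom_inv_id := hom_ext (theta_comp_thetaInv X.deg)
      inv_hom_id := hom_ext (thetaInv_comp_theta X.deg) }
  twist_naturality f := hom_ext (theta_naturality f.arity)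
  twist_tensor X Y := hom_ext (theta_add_tensor X.deg Y.deg)

/-- Every object of the internal PROB is self-dual. -/
scoped instance selfPairing (X : InternalPROB A) : ExactPairing X X where
  coevaluation' := ⟨cupPow X.deg, hasArity_cupPow X.deg⟩
  evaluation' := ⟨capPow X.deg, hasArity_capPow X.deg⟩
  coevaluation_evaluation' := by
    ext; simp [I_comp, npow_B_cupPow_comp_capPow]
  evaluation_coevaluation' := by
    ext; simp [I_comp, cupPow_comp_capPow]

scoped instance rightRigid : RightRigidCategory (InternalPROB A) where
  rightDual X := { rightDual := X }

theorem rightAdjointMate_val {X Y : InternalPROB A} (f : X ⟶ Y) :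
    (fᘁ).val = (npow B Y.deg ⬝ (cupPow X.deg ⊚ f.val)) ⊚ capPow Y.deg := by
  -- The factors `I` are the unitors and the associator of the mate.
  change I ⊚ (npow B Y.deg ⬝ cupPow X.deg) ⊚ (npow B Y.deg ⬝ f.val) ⊚ I ⊚ capPow Y.deg ⊚ I = _
  rw [I_comp, I_comp, comp_I, npow_B_comp, comp_assoc]

scoped instance ribbon : RibbonCategory (InternalPROB A) where
  twist_dual X := by
    ext
    rw [rightAdjointMate_val]
    change (npow B X.deg ⬝ (cupPow X.deg ⊚ theta X.deg)) ⊚ capPow X.deg = theta X.deg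
    have h := (hasArity_capPow (A := A) X.deg).interchange (theta X.deg)
    rw [npow_nil, I_app, npow_B_add] at h
    rw [cupPow_comp_theta, npow_B_comp, comp_assoc, h, ← comp_assoc, npow_B_cupPow_comp_capPow,
      I_comp]

/-! ### The reflexive object and its induced algebra -/

/-- The object `1` of the internal PROB is reflexive. -/
def reflexive : ReflexiveStructure (⟨1⟩ : InternalPROB A) where
  homEquiv {Y} :=
    { toFun := fun f => ⟨f.val ⊚ B, (f.arity.add_right 1).comp hasArity_B⟩
      invFun := fun f => ⟨curry Y.deg f.val, hasArity_curry Y.deg f.val⟩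
      left_inv := fun f => hom_ext <| eq_of_comp_B (hasArity_curry _ _) f.arity
        (curry_comp_B ((f.arity.add_right 1).comp hasArity_B))
      right_inv := fun f => hom_ext (curry_comp_B f.arity) }
  homEquiv_comp f g := hom_ext (comp_assoc f.val g.val B)

theorem reflexive_app_val : (reflexive (A := A)).app.val = B := I_comp B

theorem reflexive_cur_val_comp_B {Y : InternalPROB A} (f : Y ⊗ ⟨1⟩ ⟶ (⟨1⟩ : InternalPROB A)) :
    (reflexive.cur f).val ⊚ B = f.val := curry_comp_B f.arity

/-- The chosen dual of 1 is 1 itself, so lam is a word in `cup`, `θp`, `Cp` and φ. All that is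
needed of φ is that applying it gives the counit. -/
theorem reflexive_lam_val : (reflexive (A := A)).lam.val = Tr := by
  have hφ : (reflexive (A := A)).phi.val ⊚ B = B ⬝ cap := by
    have h := reflexive_cur_val_comp_B (A := A) (Y := ⟨1⟩ ⊗ (⟨1⟩ : InternalPROB A)ᘁ)
      ((α_ _ _ _).hom ≫ _ ◁ ε_ _ _ ≫ (ρ_ _).hom)
    refine h.trans ?_
    change I ⊚ (npow B 1 ⬝ capPow 1) ⊚ I = _
    rw [I_comp, comp_I, capPow_one, npow_B_one_app]
  refine Eq.trans ?_ (B_cup_comp_eq_Tr (reflexive (A := A)).phi.arity hφ)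
  change I ⊚ (npow B 1 ⬝ cupPow 1) ⊚ (npow B 1 ⬝ (npow B 1 ⬝ theta 1)) ⊚ (npow B 1 ⬝ sigma 1 1) ⊚
    I ⊚ (reflexive (A := A)).phi.val = _
  simp only [I_comp, npow_B_one_app, cupPow_one, theta_one, sigma_one_one]

/-- A global element is `cur₃ f` as soon as its threefold application is `f`. -/
theorem eq_cur₃ {a : A} {f : (⟨1⟩ ⊗ ⟨1⟩) ⊗ ⟨1⟩ ⟶ (⟨1⟩ : InternalPROB A)}
    (h : dot a ⊚ B ⊚ B ⊚ B = f.val) : dot a = (reflexive.cur₃ f).val := by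
  refine eq_of_comp_npow_B (n := 0) (k := 3) (hasArity_dot a) (reflexive.cur₃ f).arity ?_
  simp only [npow_step, npow_nil, comp_I]
  rw [h]
  unfold ReflexiveStructure.cur₃
  rw [comp_eq_assoc (reflexive_cur_val_comp_B _), comp_eq_assoc (reflexive_cur_val_comp_B _),
    reflexive_cur_val_comp_B]
  exact (I_comp f.val).symm

theorem eq_cur₂ {a : A} {f : ⟨1⟩ ⊗ ⟨1⟩ ⟶ (⟨1⟩ : InternalPROB A)}
    (h : dot a ⊚ B ⊚ B = f.val) : dot a = (reflexive.cur₂ f).val := by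
  refine eq_of_comp_npow_B (n := 0) (k := 2) (hasArity_dot a) (reflexive.cur₂ f).arity ?_
  simp only [npow_step, npow_nil, comp_I]
  rw [h]
  unfold ReflexiveStructure.cur₂
  rw [comp_eq_assoc (reflexive_cur_val_comp_B _), reflexive_cur_val_comp_B]
  exact (I_comp f.val).symm

theorem eq_cur₁ {a : A} {f : ⟨1⟩ ⟶ (⟨1⟩ : InternalPROB A)}
    (h : dot a ⊚ B = f.val) : dot a = (reflexive.cur₁ f).val := by
  refine eq_of_comp_B (n := 0) (hasArity_dot a) (reflexive.cur₁ f).arity ?_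
  rw [h]
  unfold ReflexiveStructure.cur₁
  rw [reflexive_cur_val_comp_B]
  exact (I_comp f.val).symm

/-- The algebra `A` is isomorphic to the algebra of global elements of the object `1`. -/
def globalIso : RibbonSignature.Iso (RibbonCombinatoryAlgebra.toRibbonSignature (A := A))
    (reflexive (A := A)).signature where
  toFun a := ⟨dot a, hasArity_dot a⟩
  invFun f := f.val ⬝ I
  left_inv a := dot_app_I a
  right_inv f := hom_ext <| by
    have h := HasArity.eq_dot_comp (m := 0) f.arity
    rwa [npow_nil, comp_I] at h
  map_app a b := hom_ext <| by
    change dot (a ⬝ b) = I ⊚ (dot a ⊚ (npow B 1 ⬝ dot b)) ⊚ (reflexive (A := A)).app.val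
    rw [reflexive_app_val, dot_app, I_comp, npow_B_one_app, ← comp_dot, comp_assoc]
  map_B := hom_ext <| eq_cur₃ <| by
    change _ = I ⊚ (npow B 1 ⬝ (reflexive (A := A)).app.val) ⊚ (reflexive (A := A)).app.val
    rw [reflexive_app_val, I_comp, npow_B_one_app, arity_B]
  map_Cp := hom_ext <| eq_cur₃ <| by
    change _ = I ⊚ (npow B 1 ⬝ sigma 1 1) ⊚ I ⊚ (reflexive (A := A)).app.val ⊚
      (reflexive (A := A)).app.val
    rw [reflexive_app_val, I_comp, I_comp, npow_B_one_app, sigma_one_one]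
    simpa only [HasArity, npow_step, npow_nil, comp_I] using hasArity_Cp (A := A)
  map_Cm := hom_ext <| eq_cur₃ <| by
    change _ = I ⊚ (npow B 1 ⬝ sigmaInv 1 1) ⊚ I ⊚ (reflexive (A := A)).app.val ⊚
      (reflexive (A := A)).app.val
    rw [reflexive_app_val, I_comp, I_comp, npow_B_one_app, sigmaInv_one_one]
    simpa only [HasArity, npow_step, npow_nil, comp_I] using hasArity_Cm (A := A)
  map_I := hom_ext <| eq_cur₁ dot_I_comp_B
  map_θp := hom_ext <| eq_cur₂ <| by
    change _ = (npow B 1 ⬝ theta 1) ⊚ (reflexive (A := A)).app.val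
    rw [reflexive_app_val, npow_B_one_app, theta_one, hasArity_θp.dot_comp_B]
  map_θm := hom_ext <| eq_cur₂ <| by
    change _ = (npow B 1 ⬝ thetaInv 1) ⊚ (reflexive (A := A)).app.val
    rw [reflexive_app_val, npow_B_one_app, thetaInv_one, hasArity_θm.dot_comp_B]
  map_Tr := hom_ext <| eq_cur₂ <| by
    change _ = (npow B 1 ⬝ (reflexive (A := A)).lam.val) ⊚ I ⊚ (reflexive (A := A)).app.val ⊚
      (reflexive (A := A)).app.val
    rw [reflexive_app_val, I_comp, npow_B_one_app, reflexive_lam_val]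
    simpa only [HasArity, npow_step, npow_nil, comp_I] using hasArity_Tr (A := A)

end InternalPROB

theorem mainTheorem2 (A : Type u) [RibbonCombinatoryAlgebra A] :
    ∃ (_ : RibbonCategory (InternalPROB A))
      (r : ReflexiveStructure (⟨1⟩ : InternalPROB A)),
      (∀ X Y : InternalPROB A, (β_ X Y).hom.val = RibbonSignature.sigma X.deg Y.deg) ∧
      (∀ X : InternalPROB A,
        (BalancedCategory.twist X).hom.val = RibbonSignature.theta X.deg) ∧
      r.app.val = RibbonSignature.B ∧
      ∃ e : RibbonSignature.Iso (RibbonCombinatoryAlgebra.toRibbonSignature (A := A)) r.signature,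
        ∀ a : A, (e.toEquiv a).val = RibbonSignature.dot a :=
  ⟨InternalPROB.ribbon, InternalPROB.reflexive, fun _ _ => rfl, fun _ => rfl,
    InternalPROB.reflexive_app_val, InternalPROB.globalIso, fun _ => rfl⟩
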